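/- Let $d\ge 1$, let $M$ be the number of players, and let the target $X^*\in\mathbb R^d$ and the vector of unknown crossover probabilities $\epsilon^*=(\epsilon_1,\dots,\epsilon_M)\in(0,1/2)^M$ have a joint prior density $p_0(x,\epsilon)$ with finite differential entropy (for instance, $\epsilon^*$ uniform on $(0,1/2)^M$ and independent of $X^*$). Logarithms are to base 2; $h_b(e)=-e\log e-(1-e)\log(1-e)$, and $C(e)=1-h_b(e)$ is the capacity of the binary symmetric channel with crossover probability $e$. In each cycle $n=0,1,\dots$ every player $m=1,\dots,M$ is asked one question "does $X^*$ lie in $A_n^{(m)}$?" with $A_n^{(m)}\subseteq\mathbb R^d$ Borel, and gives a binary response $Y_{n+1}^{(m)}\in\{0,1\}$. * *Joint scheme.* A joint policy chooses all $A_n^{(1)},\dots,A_n^{(M)}$ as functions of the responses of the cycles before $n$; $\mathcal F_n$ is the $\sigma$-algebra generated by these responses. Given $X^*$, $\epsilon^*$ and $\mathcal F_n$, the responses $Y_{n+1}^{(1)},\dots,Y_{n+1}^{(M)}$ are conditionally independent, and $Y_{n+1}^{(m)}$ equals $I(X^*\in A_n^{(m)})$ with probability $1-\epsilon_m$ and differs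 from it with probability $\epsilon_m$. * *Sequential scheme.* The players are asked one after another. A sequential policy chooses $A_{n,t}$ (the question to player $t+1$, $0\le t<M$) as a function of the responses of the cycles before $n$ and of those of players $1,\dots,t$ in cycle $n$; $\mathcal G_{n,t}$ is the $\sigma$-algebra generated by these responses, and $\mathcal G_n=\mathcal G_{n,0}$. Given $X^*$, $\epsilon^*$ and $\mathcal G_{n,t}$, the response of player $t+1$ equals $I(X^*\in A_{n,t})$ with probability $1-\epsilon_{t+1}$ and differs from it with probability $\epsilon_{t+1}$. Let $\mathbb E^\zeta$ be the expectation under the probability measure $\mathbb P^\zeta$ induced by a policy $\zeta$, let $p_n$ be the joint posterior density of $(X^*,\epsilon^*)$ given the responses of the cycles before $n$, and let $H(p_n)=-\int p_n\log p_n$. For a policy $\zeta$ let $$G_n^*=\operatorname*{ess\,sup}_{\zeta'}\ \mathbb E^{\zeta'}[H(p_n)-H(p_{n+1})\mid\mathcal F_n]\quad\text{(joint)},\qquad G_{seq,n}^*=\operatorname*{ess\,sup}_{\zeta'}\ \mathbb E^{\zeta'}[H(p_n)-H(p_{n+1})\mid\mathcal G_n]\quad\text{(sequential)}$$ be the maximal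 expected entropy losses in cycle $n$, where $\zeta'$ runs over the joint, respectively sequential, policies that ask the same queries as $\zeta$ in all cycles before $n$. Then for every $n$ and every policy $\zeta$ of the respective type, $\mathbb P^\zeta$-almost surely, $$G_{seq,n}^*=\mathbb E^\zeta\Big[\sum_{m=1}^M C(\epsilon_m)\,\Big|\,\mathcal G_n\Big],\qquad G_n^*=\mathbb E^\zeta\Big[\sum_{m=1}^M C(\epsilon_m)\,\Big|\,\mathcal F_n\Big].$$ In particular the two designs are equivalent on average: whatever the policies used in the past, $\mathbb E[G_{seq,n}^*]=\mathbb E[G_n^*]=\int\sum_{m=1}^M C(\epsilon_m)\,p_0(x,\epsilon)\,dx\,d\epsilon$. -/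

import Mathlib

open MeasureTheory ProbabilityTheory

noncomputable section

namespace TwentyQuestions

/-- The state space of the target. -/
abbrev Target (d : ℕ) : Type := EuclideanSpace ℝ (Fin d)

/-- Values of the pair (target location, vector of crossover probabilities). -/
abbrev Param (d M : ℕ) : Type := Target d × (Fin M → ℝ)

/-- Infinite tables of binary responses: `y n m` is the answer of player `m` in cycle `n`. -/
abbrev Responses (M : ℕ) : Type := ℕ → Fin M → Bool

/-- Binary entropy in bits. -/
def binEntropyBits (e : ℝ) : ℝ :=
  -e * Real.logb 2 e - (1 - e) * Real.logb 2 (1 - e)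

/-- Capacity (in bits) of the binary symmetric channel with crossover probability `e`. -/
def capacity (e : ℝ) : ℝ := 1 - binEntropyBits e

/-- Differential entropy (in bits) of a measure with a Lebesgue density. -/
def diffEntropy {d M : ℕ} (ν : Measure (Param d M)) : ℝ :=
  -∫ θ, (ν.rnDeriv volume θ).toReal * Real.logb 2 (ν.rnDeriv volume θ).toReal

/-- `p₀` is a joint probability density of target and crossover probabilities, carried by
`ℝ^d × (0, 1/2)^M`, with finite differential entropy. -/
structure IsPrior {d M : ℕ} (p₀ : Param d M → ℝ) : Prop where
  measurable : Measurable p₀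
  nonneg : ∀ θ, 0 ≤ p₀ θ
  integral_eq_one : ∫ θ, p₀ θ = 1
  support : ∀ θ, p₀ θ ≠ 0 → ∀ m, θ.2 m ∈ Set.Ioo (0 : ℝ) (1 / 2)
  finite_entropy : Integrable (fun θ => p₀ θ * Real.logb 2 (p₀ θ))

/-- `(k, j)` (cycle, player) precedes sub-instant `t` of cycle `n`. -/
def Before {M : ℕ} (n t k : ℕ) (j : Fin M) : Prop := k < n ∨ (k = n ∧ (j : ℕ) < t)

/-- A joint query policy: all `M` (measurable) query regions of cycle `n` are functions of the
responses obtained in the cycles before `n`. -/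
structure JointPolicy (d M : ℕ) where
  query : ℕ → Fin M → Responses M → Set (Target d)
  measurableSet_query : ∀ n m y, MeasurableSet (query n m y)
  adapted : ∀ n m y y', (∀ k j, Before n 0 k j → y k j = y' k j) → query n m y = query n m y'

/-- A sequential query policy: the (measurable) query region for player `m` in cycle `n` is a
function of the responses of the cycles before `n` and of the players before `m` in cycle `n`. -/
structure SeqPolicy (d M : ℕ) where
  query : ℕ → Fin M → Responses M → Set (Target d)
  measurableSet_query : ∀ n m y, MeasurableSet (query n m y)
  adapted : ∀ n (m : Fin M) y y', (∀ k j, Before n m k j → y k j = y' k j) →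
    query n m y = query n m y'

/-- The two joint policies ask the same queries in all cycles before `n`. -/
def JointPolicy.SamePast {d M : ℕ} (n : ℕ) (π π' : JointPolicy d M) : Prop :=
  ∀ k < n, π'.query k = π.query k

/-- The two sequential policies ask the same queries in all cycles before `n`. -/
def SeqPolicy.SamePast {d M : ℕ} (n : ℕ) (π π' : SeqPolicy d M) : Prop :=
  ∀ k < n, π'.query k = π.query k

open Classical in
/-- Binary symmetric channel: probability of answer `b` to the query "is `x ∈ A`?" for a player
with crossover probability `e`. -/
def bsc {d : ℕ} (e : ℝ) (A : Set (Target d)) (x : Target d) (b : Bool) : ℝ :=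
  if (x ∈ A ↔ b = true) then 1 - e else e

section Schemes

variable {d M : ℕ} {Ω : Type*} [MeasurableSpace Ω]

/-- The information available at sub-instant `t` of cycle `n`. The queries are functions of
past responses, so it is generated by the responses. -/
def info (Y : ℕ → Fin M → Ω → Bool) (n t : ℕ) : MeasurableSpace Ω :=
  ⨆ (k : ℕ) (j : Fin M) (_ : Before n t k j), MeasurableSpace.comap (Y k j) ⊤

/-- The information at sub-instant `t` of cycle `n` together with target and crossover
probabilities. -/
def fullInfo (X : Ω → Target d) (ε : Ω → Fin M → ℝ) (Y : ℕ → Fin M → Ω → Bool) (n t : ℕ) :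
    MeasurableSpace Ω :=
  MeasurableSpace.comap (fun ω => (X ω, ε ω)) inferInstance ⊔ info Y n t

/-- The table of responses realized at `ω`. -/
def resp (Y : ℕ → Fin M → Ω → Bool) (ω : Ω) : Responses M := fun k j => Y k j ω

/-- Under `μ`, the pair `(X, ε)` has prior density `p₀`, and the responses `Y` come from the joint
scheme with policy `π`: given target, crossover probabilities and the past cycles, the `M`
responses of a cycle are independent outputs of binary symmetric channels. -/
structure IsJointScheme (p₀ : Param d M → ℝ) (X : Ω → Target d) (ε : Ω → Fin M → ℝ)
    (Y : ℕ → Fin M → Ω → Bool) (π : JointPolicy d M) (μ : Measure Ω) : Prop where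
  isProbabilityMeasure : IsProbabilityMeasure μ
  measurable_target : Measurable X
  measurable_crossover : Measurable ε
  measurable_response : ∀ n m, Measurable (Y n m)
  prior : μ.map (fun ω => (X ω, ε ω)) = volume.withDensity (fun θ => ENNReal.ofReal (p₀ θ))
  condIndep : ∀ n (y : Fin M → Bool),
    μ⟦{ω | ∀ m, Y n m ω = y m} | fullInfo X ε Y n 0⟧ =ᵐ[μ]
      fun ω => ∏ m, (μ⟦{ω' | Y n m ω' = y m} | fullInfo X ε Y n 0⟧) ω
  channel : ∀ n m b,
    μ⟦{ω | Y n m ω = b} | fullInfo X ε Y n 0⟧ =ᵐ[μ]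
      fun ω => bsc (ε ω m) (π.query n m (resp Y ω)) (X ω) b

/-- Under `μ`, the pair `(X, ε)` has prior density `p₀`, and the responses `Y` come from the
sequential scheme with policy `π`: given target, crossover probabilities and all earlier
responses, the response of the queried player is the output of a binary symmetric channel. -/
structure IsSeqScheme (p₀ : Param d M → ℝ) (X : Ω → Target d) (ε : Ω → Fin M → ℝ)
    (Y : ℕ → Fin M → Ω → Bool) (π : SeqPolicy d M) (μ : Measure Ω) : Prop where
  isProbabilityMeasure : IsProbabilityMeasure μ
  measurable_target : Measurable X
  measurable_crossover : Measurable ε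
  measurable_response : ∀ n m, Measurable (Y n m)
  prior : μ.map (fun ω => (X ω, ε ω)) = volume.withDensity (fun θ => ENNReal.ofReal (p₀ θ))
  channel : ∀ n (m : Fin M) b,
    μ⟦{ω | Y n m ω = b} | fullInfo X ε Y n m⟧ =ᵐ[μ]
      fun ω => bsc (ε ω m) (π.query n m (resp Y ω)) (X ω) b

/-- Posterior distribution at the start of cycle `n`: the conditional law of `(X, ε)` given the
event that the responses of the cycles before `n` are those realized at `ω`. -/
def posterior (X : Ω → Target d) (ε : Ω → Fin M → ℝ) (Y : ℕ → Fin M → Ω → Bool)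
    (μ : Measure Ω) (n : ℕ) (ω : Ω) : Measure (Param d M) :=
  (ProbabilityTheory.cond μ {ω' | ∀ k < n, ∀ m, Y k m ω' = Y k m ω}).map
    (fun ω' => (X ω', ε ω'))

/-- Expected entropy loss in cycle `n`, conditional on the information at its start. -/
def cycleLoss (X : Ω → Target d) (ε : Ω → Fin M → ℝ) (Y : ℕ → Fin M → Ω → Bool)
    (μ : Measure Ω) (n : ℕ) : Ω → ℝ :=
  μ[fun ω => diffEntropy (posterior X ε Y μ n ω) - diffEntropy (posterior X ε Y μ (n + 1) ω)
    | info Y n 0]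

/-- `g` is an essential supremum, under `μ`, of the family `S` of random variables. -/
def IsEssSup (μ : Measure Ω) (S : Set (Ω → ℝ)) (g : Ω → ℝ) : Prop :=
  (∀ f ∈ S, f ≤ᵐ[μ] g) ∧ ∀ g' : Ω → ℝ, (∀ f ∈ S, f ≤ᵐ[μ] g') → g ≤ᵐ[μ] g'

/-- `g` is the maximal expected entropy loss of the joint scheme in cycle `n`, after the cycles
before `n` were played with `π`; `P π'` is the probability measure induced by the policy `π'`. -/
def IsMaxJointLoss (X : Ω → Target d) (ε : Ω → Fin M → ℝ) (Y : ℕ → Fin M → Ω → Bool)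
    (P : JointPolicy d M → Measure Ω) (π : JointPolicy d M) (n : ℕ) (g : Ω → ℝ) : Prop :=
  IsEssSup (P π) {f | ∃ π' : JointPolicy d M, JointPolicy.SamePast n π π' ∧
    f = cycleLoss X ε Y (P π') n} g

/-- The same for the sequential scheme. -/
def IsMaxSeqLoss (X : Ω → Target d) (ε : Ω → Fin M → ℝ) (Y : ℕ → Fin M → Ω → Bool)
    (P : SeqPolicy d M → Measure Ω) (π : SeqPolicy d M) (n : ℕ) (g : Ω → ℝ) : Prop :=
  IsEssSup (P π) {f | ∃ π' : SeqPolicy d M, SeqPolicy.SamePast n π π' ∧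
    f = cycleLoss X ε Y (P π') n} g

end Schemes

end TwentyQuestions

end

/-!
Fix the answers `h` of the cycles before `n`. The posterior weight `f`, the prior density times the
likelihood of `h`, depends on the policy only through its questions before `n` and is the same
function for both designs; let `Z = ∫ f`. The answers of cycle `n` determine and are determined by
which players are correct, and given the parameters these events are independent with probabilities
`1 - ε m`. Hence the answers `y`, with joint weights `Z_y`, have conditional entropy `∑ h_b(ε m)`,
and with `η t = -t log t` the entropy loss `L` of the cycle satisfies
`log 2 * Z * (𝔼[∑ C(ε m) | h] - L) = η Z + Z * log (2 ^ M) - ∑ y, η (Z_y)`.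

The right-hand side is nonnegative by Jensen's inequality and vanishes if the answers are uniform.
They become uniform in the limit when the players are asked for distinct binary digits, of index
tending to infinity, of one coordinate of the target: `Z_y` is `2 ^ (-M)` times the integral of `f`
against a product of factors `1 + a m * r m` with Rademacher functions `r m`, and every nonempty
product of them changes sign under a translation that tends to zero, so that its integral against
an integrable function tends to zero.
-/

namespace TwentyQuestions

open Filter Topology

section Translation

variable {G F ι : Type*} [AddGroup G] [TopologicalSpace G] [IsTopologicalAddGroup G]
  [MeasurableSpace G] [BorelSpace G] [NormedAddCommGroup F] {μ : Measure G}
  [μ.IsAddLeftInvariant] [IsLocallyFiniteMeasure μ] [μ.InnerRegularCompactLTTop]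
  {l : Filter ι} {g : G → F} {v : ι → G}

theorem tendsto_integral_norm_translate_sub (hg : Integrable g μ) (hv : Tendsto v l (𝓝 0)) :
    Tendsto (fun k => ∫ x, ‖g (v k + x) - g x‖ ∂μ) l (𝓝 0) := by
  have hg₁ : MemLp g 1 μ := memLp_one_iff_integrable.2 hg
  have : Fact ((1 : ENNReal) ≠ ⊤) := ⟨ENNReal.one_ne_top⟩
  have hcont : Continuous fun c : G => DomAddAct.mk c +ᵥ hg₁.toLp g :=
    (continuous_id.vadd continuous_const).comp DomAddAct.mkHomeomorph.continuous
  have hzero : DomAddAct.mk (0 : G) +ᵥ hg₁.toLp g = hg₁.toLp g := zero_vadd Gᵈᵃᵃ _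
  have hdist := tendsto_iff_dist_tendsto_zero.1 ((hcont.tendsto 0).comp hv)
  refine hdist.congr fun k => ?_
  rw [hzero, Function.comp_apply, DomAddAct.mk_vadd_toLp, dist_eq_norm, ← MemLp.toLp_sub,
    L1.norm_eq_integral_norm]
  refine integral_congr_ae ?_
  filter_upwards [MemLp.coeFn_toLp ((hg₁.comp_measurePreserving
    (measurePreserving_vadd (v k) μ)).sub hg₁)] with x hx
  exact congrArg norm hx

-- Translating by `v k` flips the sign of `R k`, so twice the integral is that of
-- `R k x • (g x - g (v k + x))`.
theorem tendsto_integral_smul_of_antiperiodic [NormedSpace ℝ F] (hg : Integrable g μ)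
    (hv : Tendsto v l (𝓝 0)) {R : ι → G → ℝ} (hR : ∀ k, Measurable (R k))
    (hR_le : ∀ k x, ‖R k x‖ ≤ 1) (hR_anti : ∀ k x, R k (v k + x) = -R k x) :
    Tendsto (fun k => ∫ x, R k x • g x ∂μ) l (𝓝 0) := by
  refine squeeze_zero_norm (fun k => ?_) (tendsto_integral_norm_translate_sub hg hv)
  have hgv : Integrable (fun x => g (v k + x)) μ := hg.comp_add_left (v k)
  have hint {f : G → F} (hf : Integrable f μ) : Integrable (fun x => R k x • f x) μ :=
    hf.bdd_smul 1 (hR k).aestronglyMeasurable (.of_forall (hR_le k))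
  have hflip : ∫ x, R k x • g (v k + x) ∂μ = -∫ x, R k x • g x ∂μ := by
    rw [← integral_add_left_eq_self (fun x => R k x • g x) (v k), ← integral_neg]
    simp only [hR_anti, neg_smul, neg_neg]
  have htwo : ∫ x, R k x • (g (v k + x) - g x) ∂μ = -((2 : ℝ) • ∫ x, R k x • g x ∂μ) := by
    simp only [smul_sub]
    rw [integral_sub (hint hgv) (hint hg), hflip, two_smul, neg_add, sub_eq_add_neg]
  calc ‖∫ x, R k x • g x ∂μ‖ ≤ ‖-((2 : ℝ) • ∫ x, R k x • g x ∂μ)‖ := by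
        rw [norm_neg, norm_smul, Real.norm_two]
        linarith [norm_nonneg (∫ x, R k x • g x ∂μ)]
    _ = ‖∫ x, R k x • (g (v k + x) - g x) ∂μ‖ := by rw [htwo]
    _ ≤ ∫ x, ‖g (v k + x) - g x‖ ∂μ := by
        refine norm_integral_le_of_norm_le (hgv.sub hg).norm (.of_forall fun x => ?_)
        rw [norm_smul]
        exact mul_le_of_le_one_left (norm_nonneg _) (hR_le k x)

end Translation

section Rademacher

/-- The `j`-th Rademacher function on the line: it is `1` on the dyadic intervals
`[i / 2 ^ j, (i + 1) / 2 ^ j)` with `i` even and `-1` on those with `i` odd. -/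
noncomputable def rademacher (j : ℕ) (t : ℝ) : ℝ := (-1) ^ ⌊2 ^ j * t⌋

theorem abs_rademacher (j : ℕ) (t : ℝ) : |rademacher j t| = 1 := by
  rw [rademacher, abs_neg_one_zpow]

theorem rademacher_eq_one_or (j : ℕ) (t : ℝ) : rademacher j t = 1 ∨ rademacher j t = -1 :=
  eq_or_eq_neg_of_abs_eq (abs_rademacher j t)

theorem measurable_rademacher (j : ℕ) : Measurable (rademacher j) :=
  (Measurable.of_discrete (f := fun i : ℤ => (-1 : ℝ) ^ i)).comp (by fun_prop)

theorem rademacher_inv_two_pow_add_self (j : ℕ) (t : ℝ) :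
    rademacher j ((2 ^ j)⁻¹ + t) = -rademacher j t := by
  have h : (2 : ℝ) ^ j * ((2 ^ j)⁻¹ + t) = 2 ^ j * t + 1 := by field_simp; ring
  rw [rademacher, h, Int.floor_add_one, zpow_add_one₀ (by norm_num), mul_neg_one, rademacher]

theorem rademacher_inv_two_pow_add_of_lt {i j : ℕ} (hij : i < j) (t : ℝ) :
    rademacher j ((2 ^ i)⁻¹ + t) = rademacher j t := by
  obtain ⟨r, rfl⟩ := Nat.exists_eq_add_of_lt hij
  have h : (2 : ℝ) ^ (i + r + 1) * ((2 ^ i)⁻¹ + t) =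
      2 ^ (i + r + 1) * t + ((2 * 2 ^ r : ℤ) : ℝ) := by
    push_cast [pow_add]; field_simp; ring
  rw [rademacher, h, Int.floor_add_intCast, zpow_add₀ (by norm_num),
    (even_two_mul _).neg_one_zpow, mul_one, rademacher]

theorem prod_rademacher_inv_two_pow_min'_add (S : Finset ℕ) (hS : S.Nonempty) (t : ℝ) :
    ∏ j ∈ S, rademacher j ((2 ^ S.min' hS)⁻¹ + t) = -∏ j ∈ S, rademacher j t := by
  rw [← Finset.mul_prod_erase S _ (S.min'_mem hS), ← Finset.mul_prod_erase S _ (S.min'_mem hS),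
    rademacher_inv_two_pow_add_self, neg_mul]
  congr 2
  exact Finset.prod_congr rfl fun j hj =>
    rademacher_inv_two_pow_add_of_lt (Finset.min'_lt_of_mem_erase_min' S hS hj) t

variable {E : Type*} [NormedAddCommGroup E] [NormedSpace ℝ E] [MeasurableSpace E] [BorelSpace E]
  {μ : Measure E} [μ.IsAddLeftInvariant] [IsLocallyFiniteMeasure μ] [μ.InnerRegularCompactLTTop]
  {L : StrongDual ℝ E}

theorem tendsto_integral_prod_rademacher_smul {F : Type*} [NormedAddCommGroup F]
    [NormedSpace ℝ F] {g : E → F} (hg : Integrable g μ) (hL : L ≠ 0) {S : Finset ℕ}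
    (hS : S.Nonempty) :
    Tendsto (fun k => ∫ x, (∏ j ∈ S, rademacher (k + j) (L x)) • g x ∂μ) atTop (𝓝 0) := by
  obtain ⟨u, hu⟩ : ∃ u, L u = 1 :=
    L.toLinearMap.surjective (fun h => hL (ContinuousLinearMap.coe_injective h)) 1
  let T (k : ℕ) : Finset ℕ := S.map (addLeftEmbedding k)
  have hT (k : ℕ) : (T k).Nonempty := hS.map
  have hmin (k : ℕ) : k ≤ (T k).min' (hT k) := by simp [T, Finset.le_min'_iff]
  have hv : Tendsto (fun k => ((2 : ℝ) ^ (T k).min' (hT k))⁻¹ • u) atTop (𝓝 0) := by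
    have hpow : Tendsto (fun k => (2 : ℝ) ^ (T k).min' (hT k)) atTop atTop :=
      (tendsto_pow_atTop_atTop_of_one_lt one_lt_two).comp (tendsto_atTop_mono hmin tendsto_id)
    simpa using (tendsto_inv_atTop_zero.comp hpow).smul_const u
  have hprod (k : ℕ) (x : E) :
      ∏ j ∈ S, rademacher (k + j) (L x) = ∏ j ∈ T k, rademacher j (L x) := by
    simp [T]
  simp only [hprod]
  refine tendsto_integral_smul_of_antiperiodic hg hv
    (fun k => Finset.measurable_prod _ fun j _ => (measurable_rademacher j).comp L.measurable)
    (fun k x => ?_) fun k x => ?_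
  · rw [Real.norm_eq_abs, Finset.abs_prod, Finset.prod_congr rfl fun j _ => abs_rademacher j _,
      Finset.prod_const_one]
  · rw [map_add, map_smul, hu, smul_eq_mul, mul_one, prod_rademacher_inv_two_pow_min'_add]

theorem tendsto_integral_mul_prod_one_add_rademacher {ι : Type*} [Fintype ι] {f : E → ℝ}
    {a : ι → E → ℝ} (hfa : ∀ S : Finset ι, Integrable (fun x => f x * ∏ i ∈ S, a i x) μ)
    (hL : L ≠ 0) (j : ι ↪ ℕ) :
    Tendsto (fun k => ∫ x, f x * ∏ i, (1 + a i x * rademacher (k + j i) (L x)) ∂μ) atTop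
      (𝓝 (∫ x, f x ∂μ)) := by
  classical
  let g (S : Finset ι) (x : E) : ℝ := f x * ∏ i ∈ S, a i x
  let R (k : ℕ) (S : Finset ι) (x : E) : ℝ := ∏ n ∈ S.map j, rademacher (k + n) (L x)
  have hR_int (k : ℕ) (S : Finset ι) : Integrable (fun x => R k S x • g S x) μ := by
    refine (hfa S).bdd_smul 1 (Finset.measurable_prod _ fun n _ =>
      (measurable_rademacher _).comp L.measurable).aestronglyMeasurable (.of_forall fun x => ?_)
    simp [abs_rademacher]
  have hexpand (k : ℕ) : ∫ x, f x * ∏ i, (1 + a i x * rademacher (k + j i) (L x)) ∂μ =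
      ∑ S : Finset ι, ∫ x, R k S x • g S x ∂μ := by
    rw [← integral_finsetSum _ fun S _ => hR_int k S]
    refine integral_congr_ae (.of_forall fun x => ?_)
    simp only [Finset.prod_one_add, Finset.powerset_univ, Finset.mul_sum, Finset.prod_mul_distrib,
      R, g, Finset.prod_map, smul_eq_mul]
    exact Finset.sum_congr rfl fun S _ => by ring
  have hlim (S : Finset ι) : Tendsto (fun k => ∫ x, R k S x • g S x ∂μ) atTop
      (𝓝 (if S = ∅ then ∫ x, f x ∂μ else 0)) := by
    split_ifs with hS
    · simp [hS, R, g]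
    · exact tendsto_integral_prod_rademacher_smul (hfa S) hL
        ((Finset.nonempty_iff_ne_empty.2 hS).map)
  simp only [hexpand]
  simpa using tendsto_finsetSum Finset.univ fun S _ => hlim S

end Rademacher

section Entropy

theorem negMulLog_prod {ι : Type*} [DecidableEq ι] (a : ι → ℝ) (s : Finset ι) :
    Real.negMulLog (∏ i ∈ s, a i) = ∑ i ∈ s, Real.negMulLog (a i) * ∏ j ∈ s.erase i, a j := by
  induction s using Finset.induction_on with
  | empty => simp
  | insert i s hi ih =>
    have herase (j : ι) (hj : j ∈ s) :
        ∏ l ∈ (insert i s).erase j, a l = a i * ∏ l ∈ s.erase j, a l := by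
      rw [Finset.erase_insert_of_ne (ne_of_mem_of_not_mem hj hi).symm,
        Finset.prod_insert fun h => hi (Finset.mem_of_mem_erase h)]
    rw [Finset.prod_insert hi, Real.negMulLog_mul, ih, Finset.sum_insert hi,
      Finset.erase_insert hi, mul_comm, Finset.mul_sum]
    congr 1
    exact Finset.sum_congr rfl fun j hj => by rw [herase j hj, mul_left_comm]

variable {ι : Type*} [Fintype ι]

theorem card_mul_negMulLog_inv_card_mul [Nonempty ι] (z : ℝ) :
    Fintype.card ι * Real.negMulLog ((Fintype.card ι : ℝ)⁻¹ * z) =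
      Real.negMulLog z + z * Real.log (Fintype.card ι) := by
  have hinv : Real.negMulLog (Fintype.card ι : ℝ)⁻¹ =
      (Fintype.card ι : ℝ)⁻¹ * Real.log (Fintype.card ι) := by
    rw [Real.negMulLog, Real.log_inv, neg_mul_neg]
  rw [Real.negMulLog_mul, hinv]
  field_simp
  ring

theorem sum_negMulLog_le {Z : ι → ℝ} (hZ : ∀ i, 0 ≤ Z i) :
    ∑ i, Real.negMulLog (Z i) ≤
      Real.negMulLog (∑ i, Z i) + (∑ i, Z i) * Real.log (Fintype.card ι) := by
  rcases isEmpty_or_nonempty ι with _ | _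
  · simp
  have hjensen := Real.concaveOn_negMulLog.le_map_sum (t := Finset.univ)
    (w := fun _ : ι => (Fintype.card ι : ℝ)⁻¹) (p := Z) (fun _ _ => by positivity)
    (by simp) fun i _ => hZ i
  simp only [smul_eq_mul, ← Finset.mul_sum] at hjensen
  rwa [inv_mul_le_iff₀ (by positivity), card_mul_negMulLog_inv_card_mul] at hjensen

theorem sum_negMulLog_prod [DecidableEq ι] {κ : Type*} [Fintype κ] {w : ι → κ → ℝ}
    (hw : ∀ i, ∑ b, w i b = 1) :
    ∑ z : ι → κ, Real.negMulLog (∏ i, w i (z i)) = ∑ i, ∑ b, Real.negMulLog (w i b) := by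
  simp only [negMulLog_prod]
  rw [Finset.sum_comm]
  refine Finset.sum_congr rfl fun i _ => ?_
  let v : ι → κ → ℝ := Function.update w i fun b => Real.negMulLog (w i b)
  have hv_ne {j : ι} (hj : j ∈ Finset.univ.erase i) : v j = w j :=
    Function.update_of_ne (Finset.ne_of_mem_erase hj) ..
  calc ∑ z : ι → κ, Real.negMulLog (w i (z i)) * ∏ j ∈ Finset.univ.erase i, w j (z j)
      = ∑ z : ι → κ, ∏ j, v j (z j) := by
        refine Finset.sum_congr rfl fun z _ => ?_
        rw [← Finset.mul_prod_erase _ _ (Finset.mem_univ i)]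
        exact congrArg₂ (· * ·) (by simp [v]) (Finset.prod_congr rfl fun j hj => by rw [hv_ne hj])
    _ = ∏ j, ∑ b, v j b := (Fintype.prod_sum v).symm
    _ = ∑ b, Real.negMulLog (w i b) := by
        rw [← Finset.mul_prod_erase _ _ (Finset.mem_univ i),
          Finset.prod_eq_one fun j hj => by rw [hv_ne hj, hw], mul_one]
        simp [v]

end Entropy

section Conditioning

variable {Ω α β : Type*} {m mΩ : MeasurableSpace Ω} [MeasurableSpace α] [MeasurableSpace β]
  {μ : Measure Ω}

theorem lintegral_ofReal_condProb [IsFiniteMeasure μ] (hm : m ≤ mΩ) {E F : Set Ω}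
    (hE : MeasurableSet[m] E) (hF : MeasurableSet F) :
    ∫⁻ ω in E, ENNReal.ofReal ((μ⟦F | m⟧) ω) ∂μ = μ (E ∩ F) := by
  have hF_int : Integrable (F.indicator fun _ => (1 : ℝ)) μ :=
    (integrable_const 1).indicator hF
  have hnonneg : 0 ≤ᵐ[μ] μ⟦F | m⟧ :=
    condExp_nonneg (.of_forall fun _ => Set.indicator_nonneg (fun _ _ => zero_le_one) _)
  rw [← ofReal_integral_eq_lintegral_ofReal integrable_condExp.restrict
      (ae_restrict_of_ae hnonneg), setIntegral_condExp hm hF_int hE, setIntegral_indicator hF,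
    setIntegral_one_eq_measureReal, ofReal_measureReal]

theorem map_restrict_inter_eq_withDensity [IsFiniteMeasure μ] (hm : m ≤ mΩ)
    {T : Ω → α} (hT : Measurable[m] T) {E F : Set Ω} (hE : MeasurableSet[m] E)
    (hF : MeasurableSet F) {ψ : α → ℝ} (hψ : Measurable ψ)
    (hcond : ∀ᵐ ω ∂μ, ω ∈ E → (μ⟦F | m⟧) ω = ψ (T ω)) :
    (μ.restrict (E ∩ F)).map T =
      ((μ.restrict E).map T).withDensity fun x => ENNReal.ofReal (ψ x) := by
  have hT' : Measurable T := hT.mono hm le_rfl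
  ext B hB
  have hTB : MeasurableSet[m] (T ⁻¹' B ∩ E) := (hT hB).inter hE
  rw [withDensity_apply _ hB, setLIntegral_map hB hψ.ennreal_ofReal hT',
    Measure.restrict_restrict (hT' hB), Measure.map_apply hT' hB, Measure.restrict_apply (hT' hB),
    ← Set.inter_assoc, ← lintegral_ofReal_condProb hm hTB hF]
  refine setLIntegral_congr_fun_ae (hm _ hTB) ?_
  filter_upwards [hcond] with ω hω hωE
  rw [hω hωE.2]

theorem withDensity_ofReal_mul {f ψ : Ω → ℝ} (hf : Measurable f) (hf_nonneg : ∀ x, 0 ≤ f x)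
    (hψ : Measurable ψ) :
    (μ.withDensity fun x => ENNReal.ofReal (f x)).withDensity (fun x => ENNReal.ofReal (ψ x)) =
      μ.withDensity fun x => ENNReal.ofReal (f x * ψ x) := by
  simp only [ENNReal.ofReal_mul (hf_nonneg _)]
  exact (withDensity_mul μ hf.ennreal_ofReal hψ.ennreal_ofReal).symm

theorem ae_measureReal_preimage_singleton_pos [IsFiniteMeasure μ] [Countable β]
    [MeasurableSingletonClass β] {V : Ω → β} (hV : Measurable V) :
    ∀ᵐ ω ∂μ, 0 < μ.real (V ⁻¹' {V ω}) := by
  refine ae_of_ae_map hV.aemeasurable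
    ((ae_iff_of_countable (p := fun b => 0 < μ.real (V ⁻¹' {b}))).2 fun b hb => ?_)
  rw [Measure.map_apply hV (measurableSet_singleton b)] at hb
  exact ENNReal.toReal_pos hb (measure_ne_top _ _)

theorem condExp_comap_mul_measureReal [IsFiniteMeasure μ] [MeasurableSingletonClass β]
    {V : Ω → β} (hV : Measurable V) {f : Ω → ℝ} (hf : Integrable f μ) (ω : Ω) :
    (μ[f | MeasurableSpace.comap V inferInstance]) ω * μ.real (V ⁻¹' {V ω}) =
      ∫ ω' in V ⁻¹' {V ω}, f ω' ∂μ := by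
  have hfiber := measurableSet_singleton (V ω)
  rw [← setIntegral_condExp hV.comap_le hf ⟨_, hfiber, rfl⟩,
    setIntegral_congr_fun (g := fun _ => (μ[f | MeasurableSpace.comap V inferInstance]) ω)
      (hV hfiber) fun ω' hω' => stronglyMeasurable_condExp.factorsThrough hω',
    setIntegral_const, smul_eq_mul, mul_comm]

theorem integrable_comp_of_finite [IsFiniteMeasure μ] [Finite β] [MeasurableSingletonClass β]
    {V : Ω → β} (hV : Measurable V) (F : β → ℝ) : Integrable (fun ω => F (V ω)) μ :=
  Integrable.of_finite.comp_measurable hV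

theorem setIntegral_eq_sum_inter_preimage_singleton [Fintype β] [MeasurableSingletonClass β]
    {V : Ω → β} (hV : Measurable V) {A : Set Ω} (hA : MeasurableSet A) {f : Ω → ℝ}
    (hf : Integrable f μ) :
    ∫ ω in A, f ω ∂μ = ∑ b, ∫ ω in A ∩ V ⁻¹' {b}, f ω ∂μ := by
  have hunion : ⋃ b, A ∩ V ⁻¹' {b} = A := by
    rw [← Set.inter_iUnion, ← Set.preimage_iUnion, Set.iUnion_of_singleton, Set.preimage_univ,
      Set.inter_univ]
  have hdisj : Pairwise (Function.onFun Disjoint fun b => A ∩ V ⁻¹' {b}) := fun b b' hb =>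
    ((Set.disjoint_singleton.2 hb).preimage V).mono Set.inter_subset_right Set.inter_subset_right
  rw [← integral_iUnion_fintype (fun b => hA.inter (hV (measurableSet_singleton b))) hdisj
    fun b => hf.integrableOn, hunion]

end Conditioning

section EssSup

variable {Ω : Type*} [MeasurableSpace Ω] {μ : Measure Ω} {S : Set (Ω → ℝ)} {g g' : Ω → ℝ}

theorem isEssSup_of_ae_tendsto (hle : ∀ f ∈ S, f ≤ᵐ[μ] g) {f : ℕ → Ω → ℝ} (hf : ∀ k, f k ∈ S)
    (hlim : ∀ᵐ ω ∂μ, Tendsto (fun k => f k ω) atTop (𝓝 (g ω))) : IsEssSup μ S g := by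
  refine ⟨hle, fun g' hg' => ?_⟩
  filter_upwards [hlim, ae_all_iff.2 fun k => hg' (f k) (hf k)] with ω hω hle'
  exact le_of_tendsto' hω hle'

theorem IsEssSup.ae_eq (hg : IsEssSup μ S g) (hg' : IsEssSup μ S g') : g =ᵐ[μ] g' :=
  (hg.2 g' hg'.1).antisymm (hg'.2 g hg.1)

end EssSup

section Channel

variable {d M : ℕ}

theorem bsc_mem_Icc {e : ℝ} (he : e ∈ Set.Icc (0 : ℝ) 1) (A : Set (Target d)) (x : Target d)
    (b : Bool) : bsc e A x b ∈ Set.Icc (0 : ℝ) 1 := by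
  unfold bsc
  split_ifs
  · exact Set.Icc.mem_iff_one_sub_mem.1 he
  · exact he

theorem measurable_bsc {A : Set (Target d)} (hA : MeasurableSet A) (m : Fin M) (b : Bool) :
    Measurable fun θ : Param d M => bsc (θ.2 m) A θ.1 b := by
  have hset : MeasurableSet {θ : Param d M | θ.1 ∈ A ↔ b = true} :=
    (measurableSet_setOfPred.2 ((measurableSet_setOfPred.1 (measurable_fst hA)).iff
      measurable_const))
  have hcross : Measurable fun θ : Param d M => θ.2 m := by fun_prop
  exact Measurable.ite hset (measurable_const.sub hcross) hcross

/-- The query asking whether the binary digit with index `j` of the coordinate `x i` is zero. -/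
def dyadicQuery (i : Fin d) (j : ℕ) : Set (Target d) := {x | rademacher j (x i) = 1}

theorem measurableSet_dyadicQuery (i : Fin d) (j : ℕ) : MeasurableSet (dyadicQuery i j) :=
  ((measurable_rademacher j).comp (EuclideanSpace.proj (𝕜 := ℝ) i).measurable)
    (measurableSet_singleton 1)

theorem bsc_dyadicQuery (e : ℝ) (i : Fin d) (j : ℕ) (x : Target d) (b : Bool) :
    bsc e (dyadicQuery i j) x b =
      2⁻¹ * (1 + (if b then 1 - 2 * e else 2 * e - 1) * rademacher j (x i)) := by
  have hne : (-1 : ℝ) ≠ 1 := by norm_num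
  rcases rademacher_eq_one_or j (x i) with h | h <;> cases b <;>
    simp [bsc, dyadicQuery, h, hne] <;> ring

theorem binEntropyBits_eq (e : ℝ) : binEntropyBits e = Real.binEntropy e / Real.log 2 := by
  simp only [binEntropyBits, Real.binEntropy, Real.logb, Real.log_inv]
  ring

theorem log_two_mul_capacity (e : ℝ) :
    Real.log 2 * capacity e = Real.log 2 - Real.binEntropy e := by
  rw [capacity, binEntropyBits_eq, mul_one_sub, mul_div_cancel₀ _ (Real.log_pos one_lt_two).ne']

theorem measurable_sum_capacity :
    Measurable fun θ : Param d M => ∑ m, capacity (θ.2 m) := by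
  unfold capacity
  simp only [binEntropyBits_eq]
  fun_prop

end Channel

/-- A nonnegative integrable weight on the parameter space that is carried by crossover
probabilities in `[0, 1]` and has finite differential entropy. It is not normalized, so the class
contains the joint densities of the parameters and an event. -/
structure IsParamDensity {d M : ℕ} (f : Param d M → ℝ) : Prop where
  measurable : Measurable f
  nonneg : ∀ θ, 0 ≤ f θ
  integrable : Integrable f
  crossover_mem : ∀ θ, f θ ≠ 0 → ∀ m, θ.2 m ∈ Set.Icc (0 : ℝ) 1
  integrable_negMulLog : Integrable fun θ => Real.negMulLog (f θ)

section Bounded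

variable {α : Type*} [MeasurableSpace α] {μ : Measure α} {f ψ : α → ℝ}

theorem integrable_mul_of_abs_le_one (hf : Integrable f μ) (hψ : Measurable ψ)
    (hψ_le : ∀ x, f x ≠ 0 → |ψ x| ≤ 1) : Integrable (fun x => f x * ψ x) μ := by
  refine hf.mono (hf.aestronglyMeasurable.mul hψ.aestronglyMeasurable) (.of_forall fun x => ?_)
  by_cases hx : f x = 0
  · simp [hx]
  · rw [norm_mul]
    exact mul_le_of_le_one_right (norm_nonneg _) (hψ_le x hx)

theorem integrable_mul_of_mem_Icc (hf : Integrable f μ) (hψ : Measurable ψ)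
    (hψ_mem : ∀ x, f x ≠ 0 → ψ x ∈ Set.Icc (0 : ℝ) 1) : Integrable (fun x => f x * ψ x) μ :=
  integrable_mul_of_abs_le_one hf hψ fun x hx =>
    (abs_of_nonneg (hψ_mem x hx).1).trans_le (hψ_mem x hx).2

end Bounded

theorem negMulLog_mem_Icc {t : ℝ} (ht : t ∈ Set.Icc (0 : ℝ) 1) :
    Real.negMulLog t ∈ Set.Icc (0 : ℝ) 1 :=
  ⟨Real.negMulLog_nonneg ht.1 ht.2,
    (Real.negMulLog_le_one_sub_self ht.1).trans (sub_le_self 1 ht.1)⟩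

theorem binEntropy_mem_Icc {e : ℝ} (he : e ∈ Set.Icc (0 : ℝ) 1) :
    Real.binEntropy e ∈ Set.Icc (0 : ℝ) 1 :=
  ⟨Real.binEntropy_nonneg he.1 he.2,
    Real.binEntropy_le_log_two.trans (by linarith [Real.log_two_lt_d9])⟩

theorem IsPrior.isParamDensity {d M : ℕ} {p₀ : Param d M → ℝ} (hp₀ : IsPrior p₀) :
    IsParamDensity p₀ where
  measurable := hp₀.measurable
  nonneg := hp₀.nonneg
  integrable := .of_integral_ne_zero (by simp [hp₀.integral_eq_one])
  crossover_mem θ hθ m :=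
    Set.Ioo_subset_Icc_self (Set.Ioo_subset_Ioo_right (by norm_num) (hp₀.support θ hθ m))
  integrable_negMulLog := by
    refine (hp₀.finite_entropy.const_mul (-Real.log 2)).congr (.of_forall fun θ => ?_)
    have hlog := (Real.log_pos one_lt_two).ne'
    simp only [Real.logb, Real.negMulLog]
    field_simp

namespace IsParamDensity

variable {d M : ℕ} {f : Param d M → ℝ}

theorem mul {ψ : Param d M → ℝ} (hf : IsParamDensity f) (hψ : Measurable ψ)
    (hψ_mem : ∀ θ, f θ ≠ 0 → ψ θ ∈ Set.Icc (0 : ℝ) 1) : IsParamDensity fun θ => f θ * ψ θ where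
  measurable := hf.measurable.mul hψ
  nonneg θ := by
    by_cases hθ : f θ = 0
    · simp [hθ]
    · exact mul_nonneg (hf.nonneg θ) (hψ_mem θ hθ).1
  integrable := integrable_mul_of_mem_Icc hf.integrable hψ hψ_mem
  crossover_mem θ hθ := hf.crossover_mem θ (left_ne_zero_of_mul hθ)
  integrable_negMulLog := by
    have hfactor := integrable_mul_of_mem_Icc hf.integrable_negMulLog hψ fun θ hθ =>
      hψ_mem θ fun h => hθ (by rw [h, Real.negMulLog_zero])
    have hcross := integrable_mul_of_mem_Icc hf.integrable
      (Real.continuous_negMulLog.measurable.comp hψ) fun θ hθ => negMulLog_mem_Icc (hψ_mem θ hθ)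
    refine (hfactor.add hcross).congr (.of_forall fun θ => ?_)
    simp only [Pi.add_apply, Function.comp_apply, Real.negMulLog_mul, mul_comm (ψ θ)]

theorem mul_prod_bsc (hf : IsParamDensity f) {ι : Type*} [Fintype ι] (m : ι → Fin M)
    {A : ι → Set (Target d)} (hA : ∀ i, MeasurableSet (A i)) (b : ι → Bool) :
    IsParamDensity fun θ => f θ * ∏ i, bsc (θ.2 (m i)) (A i) θ.1 (b i) := by
  refine hf.mul (Finset.measurable_prod _ fun i _ => measurable_bsc (hA i) (m i) (b i))
    fun θ hθ => ?_
  have hbsc (i : ι) := bsc_mem_Icc (hf.crossover_mem θ hθ (m i)) (A i) θ.1 (b i)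
  exact ⟨Finset.prod_nonneg fun i _ => (hbsc i).1,
    Finset.prod_le_one (fun i _ => (hbsc i).1) fun i _ => (hbsc i).2⟩

theorem integrable_mul_binEntropy (hf : IsParamDensity f) (m : Fin M) :
    Integrable fun θ => f θ * Real.binEntropy (θ.2 m) :=
  integrable_mul_of_mem_Icc hf.integrable (by fun_prop)
    fun θ hθ => binEntropy_mem_Icc (hf.crossover_mem θ hθ m)

theorem integrable_mul_capacity (hf : IsParamDensity f) (m : Fin M) :
    Integrable fun θ => f θ * capacity (θ.2 m) := by
  refine (hf.integrable.sub ((hf.integrable_mul_binEntropy m).div_const (Real.log 2))).congr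
    (.of_forall fun θ => ?_)
  simp only [Pi.sub_apply, capacity, binEntropyBits_eq]
  ring

theorem integrable_mul_sum_binEntropy (hf : IsParamDensity f) :
    Integrable fun θ => f θ * ∑ m, Real.binEntropy (θ.2 m) := by
  simp only [Finset.mul_sum]
  exact integrable_finsetSum _ fun m _ => hf.integrable_mul_binEntropy m

theorem log_two_mul_integral_mul_sum_capacity (hf : IsParamDensity f) :
    Real.log 2 * ∫ θ, f θ * ∑ m, capacity (θ.2 m) =
      (∫ θ, f θ) * Real.log (Fintype.card (Fin M → Bool)) -
        ∫ θ, f θ * ∑ m, Real.binEntropy (θ.2 m) := by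
  rw [← integral_const_mul, ← integral_mul_const,
    ← integral_sub (hf.integrable.mul_const _) hf.integrable_mul_sum_binEntropy]
  refine integral_congr_ae (.of_forall fun θ => ?_)
  simp only [mul_left_comm (Real.log 2), Finset.mul_sum (a := Real.log 2), log_two_mul_capacity,
    Finset.sum_sub_distrib, Finset.sum_const, Finset.card_univ, Fintype.card_pi_const,
    Fintype.card_fin, Fintype.card_bool, nsmul_eq_mul, Nat.cast_pow, Nat.cast_ofNat, Real.log_pow,
    mul_sub]

theorem log_two_mul_integral_mul_diffEntropy (hf : IsParamDensity f) (hpos : 0 < ∫ θ, f θ) :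
    Real.log 2 * ((∫ θ, f θ) *
        diffEntropy (volume.withDensity fun θ => ENNReal.ofReal ((∫ θ, f θ)⁻¹ * f θ))) =
      (∫ θ, Real.negMulLog (f θ)) - Real.negMulLog (∫ θ, f θ) := by
  set Z := ∫ θ, f θ with hZ
  have hentropy : Real.log 2 *
      diffEntropy (volume.withDensity fun θ => ENNReal.ofReal (Z⁻¹ * f θ)) =
        ∫ θ, Real.negMulLog (Z⁻¹ * f θ) := by
    rw [diffEntropy, mul_neg, ← integral_const_mul, ← integral_neg]
    refine integral_congr_ae ?_
    filter_upwards [Measure.rnDeriv_withDensity volume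
      (hf.measurable.const_mul Z⁻¹).ennreal_ofReal] with θ hθ
    have hlog := (Real.log_pos one_lt_two).ne'
    rw [hθ, ENNReal.toReal_ofReal (mul_nonneg (inv_nonneg.2 hpos.le) (hf.nonneg θ)),
      Real.logb, Real.negMulLog]
    field_simp
  rw [mul_left_comm, hentropy]
  simp only [Real.negMulLog_mul]
  rw [integral_add (hf.integrable.mul_const _) (hf.integrable_negMulLog.const_mul _),
    integral_mul_const, integral_const_mul, ← hZ, Real.negMulLog, Real.negMulLog, Real.log_inv]
  field_simp
  ring

end IsParamDensity

section Likelihood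

variable {d M : ℕ}

/-- The likelihood of the parameters `θ` under the answers `h n` to the questions that the policy
`q` asks in cycle `n` along the table `h`. -/
noncomputable def cycleLik (q : SeqPolicy d M) (n : ℕ) (h : Responses M) (θ : Param d M) : ℝ :=
  ∏ m, bsc (θ.2 m) (q.query n m h) θ.1 (h n m)

/-- The joint density of the parameters and of the event that the answers of the cycles before `n`
agree with the table `h`, i.e. the unnormalized posterior density. -/
noncomputable def posteriorWeight (p₀ : Param d M → ℝ) (q : SeqPolicy d M) (n : ℕ)
    (h : Responses M) (θ : Param d M) : ℝ :=
  p₀ θ * ∏ k ∈ Finset.range n, cycleLik q k h θ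

/-- The probability that the answers of the cycles before `n` agree with the table `h`. -/
noncomputable def evidence (p₀ : Param d M → ℝ) (q : SeqPolicy d M) (n : ℕ) (h : Responses M) :
    ℝ :=
  ∫ θ, posteriorWeight p₀ q n h θ

variable {p₀ : Param d M → ℝ} {q q' : SeqPolicy d M} {n : ℕ} {h h' : Responses M}

theorem cycleLik_congr (hh : ∀ k ≤ n, h k = h' k) : cycleLik q n h = cycleLik q n h' := by
  have hquery (m : Fin M) : q.query n m h = q.query n m h' :=
    q.adapted n m h h' fun k j hk => congrFun (hh k (hk.elim le_of_lt fun e => e.1.le)) j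
  funext θ
  simp only [cycleLik, hquery, hh n le_rfl]

theorem posteriorWeight_succ (θ : Param d M) :
    posteriorWeight p₀ q (n + 1) h θ = posteriorWeight p₀ q n h θ * cycleLik q n h θ := by
  simp only [posteriorWeight, Finset.prod_range_succ, mul_assoc]

theorem posteriorWeight_succ_update (y : Fin M → Bool) (θ : Param d M) :
    posteriorWeight p₀ q (n + 1) (Function.update h n y) θ =
      posteriorWeight p₀ q n h θ * cycleLik q n (Function.update h n y) θ := by
  rw [posteriorWeight_succ, posteriorWeight, posteriorWeight]
  congr 2
  refine Finset.prod_congr rfl fun k hk => congrFun (cycleLik_congr fun l hl => ?_) θ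
  exact Function.update_of_ne (hl.trans_lt (Finset.mem_range.1 hk)).ne ..

theorem posteriorWeight_eq_of_samePast (hq : SeqPolicy.SamePast n q q') :
    posteriorWeight p₀ q' n h = posteriorWeight p₀ q n h := by
  funext θ
  refine congrArg (p₀ θ * ·) (Finset.prod_congr rfl fun k hk => ?_)
  simp only [cycleLik, hq k (Finset.mem_range.1 hk)]

theorem evidence_eq_of_samePast (hq : SeqPolicy.SamePast n q q') :
    evidence p₀ q' n h = evidence p₀ q n h := by
  rw [evidence, posteriorWeight_eq_of_samePast hq, evidence]

theorem IsParamDensity.posteriorWeight (hp₀ : IsParamDensity p₀) (q : SeqPolicy d M) (n : ℕ)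
    (h : Responses M) : IsParamDensity (posteriorWeight p₀ q n h) := by
  induction n with
  | zero => rwa [show TwentyQuestions.posteriorWeight p₀ q 0 h = p₀ from funext fun θ => mul_one _]
  | succ n ih =>
    rw [show TwentyQuestions.posteriorWeight p₀ q (n + 1) h = _ from funext posteriorWeight_succ]
    exact ih.mul_prod_bsc id (fun m => q.measurableSet_query n m h) (h n)

theorem IsParamDensity.evidence_nonneg (hp₀ : IsParamDensity p₀) (q : SeqPolicy d M) (n : ℕ)
    (h : Responses M) : 0 ≤ evidence p₀ q n h :=
  integral_nonneg (hp₀.posteriorWeight q n h).nonneg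

section Correctness

variable (q n h)

open Classical in
/-- The players' correctness as a vector of bits; given `x`, it determines the answers, and under
the likelihood of a cycle its entries are independent. -/
noncomputable def correctness (x : Target d) (y : Fin M → Bool) (m : Fin M) : Bool :=
  decide (x ∈ q.query n m (Function.update h n y) ↔ y m = true)

theorem bijective_correctness (x : Target d) : Function.Bijective (correctness q n h x) := by
  refine Finite.injective_iff_bijective.1 fun y y' hyy' => ?_
  suffices ∀ t (ht : t < M), y ⟨t, ht⟩ = y' ⟨t, ht⟩ from funext fun m => this m m.2
  intro t
  induction t using Nat.strong_induction_on with
  | _ t ih =>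
    intro ht
    have hquery : q.query n ⟨t, ht⟩ (Function.update h n y) =
        q.query n ⟨t, ht⟩ (Function.update h n y') := by
      refine q.adapted _ _ _ _ fun k j hk => ?_
      rcases hk with hk | ⟨rfl, hj⟩
      · simp only [Function.update_of_ne hk.ne]
      · simpa only [Function.update_self] using ih j hj j.2
    have ht_eq := congrFun hyy' ⟨t, ht⟩
    simp only [correctness, hquery, decide_eq_decide] at ht_eq
    rw [Bool.eq_iff_iff]
    tauto

theorem cycleLik_update (y : Fin M → Bool) (θ : Param d M) :
    cycleLik q n (Function.update h n y) θ =
      ∏ m, if correctness q n h θ.1 y m then 1 - θ.2 m else θ.2 m := by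
  refine Finset.prod_congr rfl fun m _ => ?_
  rw [Function.update_self, bsc]
  by_cases hm : θ.1 ∈ q.query n m (Function.update h n y) ↔ y m = true <;>
    simp [correctness, hm]

theorem sum_cycleLik_update (θ : Param d M) :
    ∑ y, cycleLik q n (Function.update h n y) θ = 1 := by
  simp only [cycleLik_update]
  rw [(bijective_correctness q n h θ.1).sum_comp
    fun z => ∏ m, if z m then 1 - θ.2 m else θ.2 m,
    ← Fintype.prod_sum fun m (b : Bool) => if b then 1 - θ.2 m else θ.2 m]
  simp

theorem sum_negMulLog_cycleLik_update (θ : Param d M) :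
    ∑ y, Real.negMulLog (cycleLik q n (Function.update h n y) θ) =
      ∑ m, Real.binEntropy (θ.2 m) := by
  simp only [cycleLik_update]
  rw [(bijective_correctness q n h θ.1).sum_comp
    fun z => Real.negMulLog (∏ m, if z m then 1 - θ.2 m else θ.2 m),
    sum_negMulLog_prod (w := fun m (b : Bool) => if b then 1 - θ.2 m else θ.2 m) (by simp)]
  simp [Real.binEntropy_eq_negMulLog_add_negMulLog_one_sub, add_comm]

end Correctness

theorem sum_evidence_update (hp₀ : IsParamDensity p₀) :
    ∑ y, evidence p₀ q (n + 1) (Function.update h n y) = evidence p₀ q n h := by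
  unfold evidence
  rw [← integral_finsetSum _ fun y _ => (hp₀.posteriorWeight q (n + 1) _).integrable]
  simp only [posteriorWeight_succ_update, ← Finset.mul_sum, sum_cycleLik_update, mul_one]

theorem sum_integral_negMulLog_posteriorWeight_update (hp₀ : IsParamDensity p₀) :
    ∑ y, ∫ θ, Real.negMulLog (posteriorWeight p₀ q (n + 1) (Function.update h n y) θ) =
      ∫ θ, Real.negMulLog (posteriorWeight p₀ q n h θ) +
        posteriorWeight p₀ q n h θ * ∑ m, Real.binEntropy (θ.2 m) := by
  rw [← integral_finsetSum _ fun y _ => (hp₀.posteriorWeight q (n + 1) _).integrable_negMulLog]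
  simp only [posteriorWeight_succ_update, Real.negMulLog_mul, Finset.sum_add_distrib,
    ← Finset.sum_mul, ← Finset.mul_sum, sum_cycleLik_update, one_mul,
    sum_negMulLog_cycleLik_update]

theorem posteriorWeight_dyadicQuery (i : Fin d) (k : ℕ)
    (hquery : ∀ m h', q.query n m h' = dyadicQuery i (k + m)) (y : Fin M → Bool) (θ : Param d M) :
    posteriorWeight p₀ q (n + 1) (Function.update h n y) θ =
      (Fintype.card (Fin M → Bool) : ℝ)⁻¹ * (posteriorWeight p₀ q n h θ *
        ∏ m, (1 + (if y m then 1 - 2 * θ.2 m else 2 * θ.2 m - 1) *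
          rademacher (k + m) (θ.1 i))) := by
  have hcard : ∏ _m : Fin M, (2 : ℝ)⁻¹ = (Fintype.card (Fin M → Bool) : ℝ)⁻¹ := by simp
  rw [posteriorWeight_succ_update]
  simp only [cycleLik, hquery, bsc_dyadicQuery, Function.update_self]
  rw [Finset.prod_mul_distrib, hcard, mul_left_comm]

theorem tendsto_evidence_dyadicQuery (hp₀ : IsParamDensity p₀) (i : Fin d)
    {q : ℕ → SeqPolicy d M} {f : Param d M → ℝ} (hf : ∀ k, posteriorWeight p₀ (q k) n h = f)
    (hquery : ∀ k m h', (q k).query n m h' = dyadicQuery i (k + m)) (y : Fin M → Bool) :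
    Tendsto (fun k => evidence p₀ (q k) (n + 1) (Function.update h n y)) atTop
      (𝓝 ((Fintype.card (Fin M → Bool) : ℝ)⁻¹ * ∫ θ, f θ)) := by
  have hf_density : IsParamDensity f := hf 0 ▸ hp₀.posteriorWeight (q 0) n h
  let coord : StrongDual ℝ (Param d M) :=
    (EuclideanSpace.proj i).comp (ContinuousLinearMap.fst ℝ (Target d) (Fin M → ℝ))
  have hcoord : coord ≠ 0 := fun h0 => by
    simpa [coord] using DFunLike.congr_fun h0 (EuclideanSpace.single i 1, 0)
  let a (m : Fin M) (θ : Param d M) : ℝ := if y m then 1 - 2 * θ.2 m else 2 * θ.2 m - 1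
  have ha_meas (m : Fin M) : Measurable (a m) := by
    unfold a
    split_ifs <;> fun_prop
  have ha_le (m : Fin M) (θ : Param d M) (hθ : f θ ≠ 0) : |a m θ| ≤ 1 := by
    obtain ⟨h0, h1⟩ := hf_density.crossover_mem θ hθ m
    unfold a
    split_ifs <;> exact abs_le.2 ⟨by linarith, by linarith⟩
  have hfa (S : Finset (Fin M)) : Integrable fun θ => f θ * ∏ m ∈ S, a m θ := by
    refine integrable_mul_of_abs_le_one hf_density.integrable
      (Finset.measurable_prod S fun m _ => ha_meas m) fun θ hθ => ?_
    rw [Finset.abs_prod]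
    exact Finset.prod_le_one (fun _ _ => abs_nonneg _) fun m _ => ha_le m θ hθ
  have : (volume : Measure (Param d M)).IsAddLeftInvariant :=
    Measure.prod.instIsAddLeftInvariant (μ := volume) (ν := volume)
  simp only [evidence, posteriorWeight_dyadicQuery i _ (hquery _), hf, integral_const_mul]
  exact (tendsto_integral_mul_prod_one_add_rademacher hfa hcoord Fin.valEmbedding).const_mul _

end Likelihood

section History

variable {M : ℕ} {Ω : Type*} {Y : ℕ → Fin M → Ω → Bool} {n : ℕ} {h : Responses M}

/-- The event that the answers preceding sub-instant `t` of cycle `n` agree with the table `h`. -/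
def cylinder (Y : ℕ → Fin M → Ω → Bool) (n t : ℕ) (h : Responses M) : Set Ω :=
  {ω | ∀ k j, Before n t k j → Y k j ω = h k j}

/-- The finite table of the answers of the cycles before `n`. -/
def history (Y : ℕ → Fin M → Ω → Bool) (n : ℕ) (ω : Ω) (k : Fin n) (j : Fin M) : Bool := Y k j ω

theorem before_zero_iff {k : ℕ} {j : Fin M} : Before n 0 k j ↔ k < n := by
  simp only [Before, Nat.not_lt_zero, and_false, or_false]

theorem cylinder_resp (Y : ℕ → Fin M → Ω → Bool) (n : ℕ) (ω : Ω) :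
    cylinder Y n 0 (resp Y ω) = history Y n ⁻¹' {history Y n ω} := by
  ext ω'
  simp only [cylinder, before_zero_iff, Set.mem_ofPred_eq, Set.mem_preimage,
    Set.mem_singleton_iff, funext_iff, history]
  exact ⟨fun H k j => H k j k.2, fun H k j hk => H ⟨k, hk⟩ j⟩

theorem cylinder_resp_of_mem {t : ℕ} {ω : Ω} (hω : ω ∈ cylinder Y n t h) :
    cylinder Y n t (resp Y ω) = cylinder Y n t h :=
  Set.ext fun _ => forall₃_congr fun k j hk => by rw [← hω k j hk]; rfl

theorem cylinder_zero_zero : cylinder Y 0 0 h = Set.univ := by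
  simp [cylinder, before_zero_iff]

theorem cylinder_succ_zero :
    cylinder Y (n + 1) 0 h = cylinder Y n 0 h ∩ {ω | ∀ m, Y n m ω = h n m} := by
  ext ω
  simp only [cylinder, before_zero_iff, Set.mem_inter_iff, Set.mem_ofPred_eq, Nat.lt_succ_iff]
  refine ⟨fun H => ⟨fun k j hk => H k j hk.le, fun m => H n m le_rfl⟩, fun H k j hk => ?_⟩
  rcases hk.lt_or_eq with hk | rfl
  exacts [H.1 k j hk, H.2 j]

theorem cylinder_card : cylinder Y n M h = cylinder Y (n + 1) 0 h := by
  ext ω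
  refine forall₂_congr fun k j => imp_congr_left ?_
  simp only [Before, j.2, and_true, Nat.not_lt_zero, and_false, or_false]
  omega

theorem cylinder_succ (m : Fin M) :
    cylinder Y n (m + 1) h = cylinder Y n m h ∩ {ω | Y n m ω = h n m} := by
  ext ω
  simp only [cylinder, Before, Nat.lt_succ_iff, Set.mem_inter_iff, Set.mem_ofPred_eq]
  refine ⟨fun H => ⟨fun k j hk => H k j (hk.imp_right fun e => ⟨e.1, e.2.le⟩),
    H n m (.inr ⟨rfl, le_rfl⟩)⟩, ?_⟩
  rintro ⟨H, Hm⟩ k j (hk | ⟨rfl, hj⟩)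
  · exact H k j (.inl hk)
  · rcases hj.lt_or_eq with hj | hj
    · exact H k j (.inr ⟨rfl, hj⟩)
    · rwa [Fin.ext hj]

theorem cylinder_succ_update (y : Fin M → Bool) :
    cylinder Y (n + 1) 0 (Function.update h n y) =
      cylinder Y n 0 h ∩ (fun ω m => Y n m ω) ⁻¹' {y} := by
  have hpast : cylinder Y n 0 (Function.update h n y) = cylinder Y n 0 h := by
    refine Set.ext fun ω => forall₃_congr fun k j hk => ?_
    rw [Function.update_of_ne (before_zero_iff.1 hk).ne]
  rw [cylinder_succ_zero, hpast, Function.update_self]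
  simp only [Set.preimage, Set.mem_singleton_iff, funext_iff]

theorem measurable_response_info {t k : ℕ} {j : Fin M} (hk : Before n t k j) :
    Measurable[info Y n t] (Y k j) :=
  measurable_iff_comap_le.2 (le_iSup_of_le k (le_iSup_of_le j (le_iSup_of_le hk le_rfl)))

theorem measurableSet_cylinder (Y : ℕ → Fin M → Ω → Bool) (n t : ℕ) (h : Responses M) :
    MeasurableSet[info Y n t] (cylinder Y n t h) := by
  simp only [cylinder, Set.ofPred_forall]
  exact .iInter fun k => .iInter fun j => .iInter fun hk =>
    measurable_response_info hk (measurableSet_singleton (h k j))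

theorem info_eq_comap_history (Y : ℕ → Fin M → Ω → Bool) (n : ℕ) :
    info Y n 0 = MeasurableSpace.comap (history Y n) inferInstance := by
  refine le_antisymm (iSup_le fun k => iSup_le fun j => iSup_le fun hk => ?_)
    (measurable_iff_comap_le.1 ?_)
  · have hcoord : Measurable fun a : Fin n → Fin M → Bool => a ⟨k, before_zero_iff.1 hk⟩ j := by
      fun_prop
    exact (hcoord.comp (comap_measurable (history Y n))).comap_le
  · exact @measurable_pi_lambda _ _ _ (info Y n 0) _ _ fun k =>
      @measurable_pi_lambda _ _ _ (info Y n 0) _ _ fun j =>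
        measurable_response_info (before_zero_iff.2 k.2)

section FullInfo

variable {d : ℕ} (X : Ω → Target d) (ε : Ω → Fin M → ℝ) (Y : ℕ → Fin M → Ω → Bool) (n t : ℕ)

theorem measurable_fullInfo : Measurable[fullInfo X ε Y n t] fun ω => (X ω, ε ω) :=
  measurable_iff_comap_le.2 le_sup_left

theorem measurableSet_fullInfo_cylinder (h : Responses M) :
    MeasurableSet[fullInfo X ε Y n t] (cylinder Y n t h) :=
  le_sup_right (a := MeasurableSpace.comap (fun ω => (X ω, ε ω)) inferInstance) _
    (measurableSet_cylinder Y n t h)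

end FullInfo

variable [mΩ : MeasurableSpace Ω]

theorem measurable_history (hY : ∀ n m, Measurable (Y n m)) (n : ℕ) : Measurable (history Y n) :=
  measurable_pi_lambda _ fun k => measurable_pi_lambda _ (hY k)

theorem fullInfo_le {d : ℕ} {X : Ω → Target d} {ε : Ω → Fin M → ℝ} (hX : Measurable X)
    (hε : Measurable ε) (hY : ∀ n m, Measurable (Y n m)) (n t : ℕ) : fullInfo X ε Y n t ≤ mΩ :=
  sup_le (hX.prodMk hε).comap_le
    (iSup_le fun k => iSup_le fun j => iSup_le fun _ => (hY k j).comap_le)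

end History

section Schemes

variable {d M : ℕ} {Ω : Type*} [MeasurableSpace Ω] {p₀ : Param d M → ℝ} {X : Ω → Target d}
  {ε : Ω → Fin M → ℝ} {Y : ℕ → Fin M → Ω → Bool} {μ : Measure Ω}

/-- Under `μ`, the joint density of the parameters `(X, ε)` and of a table of answers is the
likelihood that the policy `q` assigns to it. This is all that the two designs have in common, and
all that the expected entropy losses depend on. -/
structure HasLikelihood (p₀ : Param d M → ℝ) (X : Ω → Target d) (ε : Ω → Fin M → ℝ)
    (Y : ℕ → Fin M → Ω → Bool) (q : SeqPolicy d M) (μ : Measure Ω) : Prop where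
  isProbabilityMeasure : IsProbabilityMeasure μ
  measurable_target : Measurable X
  measurable_crossover : Measurable ε
  measurable_response : ∀ n m, Measurable (Y n m)
  map_restrict_cylinder : ∀ n h, (μ.restrict (cylinder Y n 0 h)).map (fun ω => (X ω, ε ω)) =
    volume.withDensity fun θ => ENNReal.ofReal (posteriorWeight p₀ q n h θ)

theorem IsSeqScheme.map_restrict_cylinder {q : SeqPolicy d M} {n : ℕ} {h : Responses M}
    (hp₀ : IsParamDensity p₀) (hμ : IsSeqScheme p₀ X ε Y q μ)
    (hn : (μ.restrict (cylinder Y n 0 h)).map (fun ω => (X ω, ε ω)) =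
      volume.withDensity fun θ => ENNReal.ofReal (posteriorWeight p₀ q n h θ))
    {t : ℕ} (ht : t ≤ M) :
    (μ.restrict (cylinder Y n t h)).map (fun ω => (X ω, ε ω)) =
      volume.withDensity fun θ => ENNReal.ofReal (posteriorWeight p₀ q n h θ *
        ∏ j : Fin t, bsc (θ.2 (j.castLE ht)) (q.query n (j.castLE ht) h) θ.1
          (h n (j.castLE ht))) := by
  have := hμ.isProbabilityMeasure
  induction t with
  | zero => simpa using hn
  | succ t ih =>
    have hpast : IsParamDensity fun θ => posteriorWeight p₀ q n h θ *
        ∏ j : Fin t, bsc (θ.2 (j.castLE (Nat.le_of_succ_le ht)))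
          (q.query n (j.castLE (Nat.le_of_succ_le ht)) h) θ.1
          (h n (j.castLE (Nat.le_of_succ_le ht))) :=
      (hp₀.posteriorWeight q n h).mul_prod_bsc _ (fun j => q.measurableSet_query ..) _
    let m : Fin M := ⟨t, ht⟩
    have hbsc := measurable_bsc (q.measurableSet_query n m h) m (h n m)
    have hchannel : ∀ᵐ ω ∂μ, ω ∈ cylinder Y n m h →
        (μ⟦{ω' | Y n m ω' = h n m} | fullInfo X ε Y n m⟧) ω =
          bsc (ε ω m) (q.query n m h) (X ω) (h n m) := by
      filter_upwards [hμ.channel n m (h n m)] with ω hω hmem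
      rw [hω, q.adapted n m (resp Y ω) h hmem]
    have hstep := map_restrict_inter_eq_withDensity
      (fullInfo_le hμ.measurable_target hμ.measurable_crossover hμ.measurable_response n m)
      (measurable_fullInfo X ε Y n m) (measurableSet_fullInfo_cylinder X ε Y n m h)
      (hμ.measurable_response n m (measurableSet_singleton (h n m))) hbsc hchannel
    rw [ih (Nat.le_of_succ_le ht), withDensity_ofReal_mul hpast.measurable hpast.nonneg hbsc]
      at hstep
    simp only [Fin.prod_univ_castSucc, ← mul_assoc]
    exact (congrArg _ (congrArg _ (cylinder_succ m))).trans hstep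

theorem IsSeqScheme.hasLikelihood {q : SeqPolicy d M} (hp₀ : IsParamDensity p₀)
    (hμ : IsSeqScheme p₀ X ε Y q μ) : HasLikelihood p₀ X ε Y q μ where
  isProbabilityMeasure := hμ.isProbabilityMeasure
  measurable_target := hμ.measurable_target
  measurable_crossover := hμ.measurable_crossover
  measurable_response := hμ.measurable_response
  map_restrict_cylinder n h := by
    induction n with
    | zero => simp [cylinder_zero_zero, posteriorWeight, hμ.prior]
    | succ n ih =>
      rw [← cylinder_card, hμ.map_restrict_cylinder hp₀ ih le_rfl]
      simp only [posteriorWeight_succ, cycleLik, Fin.castLE_rfl, id]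

/-- A joint policy, as a sequential policy that ignores the answers of the current cycle. -/
def JointPolicy.toSeq (π : JointPolicy d M) : SeqPolicy d M where
  query := π.query
  measurableSet_query := π.measurableSet_query
  adapted n m y y' hy := π.adapted n m y y' fun k j hk => hy k j (.inl (before_zero_iff.1 hk))

theorem IsJointScheme.hasLikelihood {π : JointPolicy d M} (hp₀ : IsParamDensity p₀)
    (hμ : IsJointScheme p₀ X ε Y π μ) : HasLikelihood p₀ X ε Y π.toSeq μ where
  isProbabilityMeasure := hμ.isProbabilityMeasure
  measurable_target := hμ.measurable_target
  measurable_crossover := hμ.measurable_crossover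
  measurable_response := hμ.measurable_response
  map_restrict_cylinder n h := by
    have := hμ.isProbabilityMeasure
    induction n with
    | zero => simp [cylinder_zero_zero, posteriorWeight, hμ.prior]
    | succ n ih =>
      have hpast := hp₀.posteriorWeight π.toSeq n h
      have hlik : Measurable (cycleLik π.toSeq n h) := Finset.measurable_prod _ fun m _ =>
        measurable_bsc (π.measurableSet_query n m h) m (h n m)
      have hanswers : MeasurableSet {ω | ∀ m, Y n m ω = h n m} := by
        simp only [Set.ofPred_forall]
        exact .iInter fun m => hμ.measurable_response n m (measurableSet_singleton (h n m))
      have hchannel : ∀ᵐ ω ∂μ, ω ∈ cylinder Y n 0 h →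
          (μ⟦{ω' | ∀ m, Y n m ω' = h n m} | fullInfo X ε Y n 0⟧) ω =
            cycleLik π.toSeq n h (X ω, ε ω) := by
        filter_upwards [hμ.condIndep n (h n), ae_all_iff.2 fun m => hμ.channel n m (h n m)]
          with ω hindep hω hmem
        rw [hindep]
        refine Finset.prod_congr rfl fun m _ => ?_
        rw [hω, π.adapted n m (resp Y ω) h hmem]
        rfl
      rw [cylinder_succ_zero, map_restrict_inter_eq_withDensity
        (fullInfo_le hμ.measurable_target hμ.measurable_crossover hμ.measurable_response n 0)
        (measurable_fullInfo X ε Y n 0) (measurableSet_fullInfo_cylinder X ε Y n 0 h) hanswers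
        hlik hchannel, ih, withDensity_ofReal_mul hpast.measurable hpast.nonneg hlik]
      simp only [posteriorWeight_succ]

end Schemes

namespace HasLikelihood

variable {d M : ℕ} {Ω : Type*} [MeasurableSpace Ω] {p₀ : Param d M → ℝ} {X : Ω → Target d}
  {ε : Ω → Fin M → ℝ} {Y : ℕ → Fin M → Ω → Bool} {q : SeqPolicy d M} {μ : Measure Ω}

theorem measurableSet_cylinder (hμ : HasLikelihood p₀ X ε Y q μ) (n : ℕ) (h : Responses M) :
    MeasurableSet (cylinder Y n 0 h) :=
  le_sup_right.trans (fullInfo_le hμ.measurable_target hμ.measurable_crossover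
    hμ.measurable_response n 0) _ (TwentyQuestions.measurableSet_cylinder Y n 0 h)

theorem measure_cylinder (hp₀ : IsParamDensity p₀) (hμ : HasLikelihood p₀ X ε Y q μ) (n : ℕ)
    (h : Responses M) : μ (cylinder Y n 0 h) = ENNReal.ofReal (evidence p₀ q n h) := by
  have hf := hp₀.posteriorWeight q n h
  rw [evidence, ofReal_integral_eq_lintegral_ofReal hf.integrable (.of_forall hf.nonneg),
    ← setLIntegral_univ, ← withDensity_apply _ .univ, ← hμ.map_restrict_cylinder,
    Measure.map_apply (hμ.measurable_target.prodMk hμ.measurable_crossover) .univ,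
    Set.preimage_univ, Measure.restrict_apply_univ]

theorem measureReal_cylinder (hp₀ : IsParamDensity p₀) (hμ : HasLikelihood p₀ X ε Y q μ) (n : ℕ)
    (h : Responses M) : μ.real (cylinder Y n 0 h) = evidence p₀ q n h := by
  rw [measureReal_def, hμ.measure_cylinder hp₀,
    ENNReal.toReal_ofReal (hp₀.evidence_nonneg q n h)]

theorem ae_evidence_pos (hp₀ : IsParamDensity p₀) (hμ : HasLikelihood p₀ X ε Y q μ) (n : ℕ) :
    ∀ᵐ ω ∂μ, 0 < evidence p₀ q n (resp Y ω) := by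
  have := hμ.isProbabilityMeasure
  simpa only [← cylinder_resp, hμ.measureReal_cylinder hp₀] using
    ae_measureReal_preimage_singleton_pos (μ := μ) (measurable_history hμ.measurable_response n)

theorem setIntegral_cylinder_comp (hp₀ : IsParamDensity p₀) (hμ : HasLikelihood p₀ X ε Y q μ)
    (n : ℕ) (h : Responses M) {G : Param d M → ℝ} (hG : Measurable G) :
    ∫ ω in cylinder Y n 0 h, G (X ω, ε ω) ∂μ = ∫ θ, posteriorWeight p₀ q n h θ * G θ := by
  have hf := hp₀.posteriorWeight q n h
  rw [← integral_map (φ := fun ω => (X ω, ε ω))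
      (hμ.measurable_target.prodMk hμ.measurable_crossover).aemeasurable
      hG.aestronglyMeasurable, hμ.map_restrict_cylinder,
    integral_withDensity_eq_integral_toReal_smul hf.measurable.ennreal_ofReal
      (.of_forall fun _ => ENNReal.ofReal_lt_top)]
  simp only [ENNReal.toReal_ofReal (hf.nonneg _), smul_eq_mul]

theorem map_eq_withDensity (hμ : HasLikelihood p₀ X ε Y q μ) :
    μ.map (fun ω => (X ω, ε ω)) = volume.withDensity fun θ => ENNReal.ofReal (p₀ θ) := by
  simpa [cylinder_zero_zero, posteriorWeight] using hμ.map_restrict_cylinder 0 default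

theorem integrable_sum_capacity (hp₀ : IsParamDensity p₀) (hμ : HasLikelihood p₀ X ε Y q μ) :
    Integrable (fun ω => ∑ m, capacity (ε ω m)) μ := by
  have hparam : Integrable (fun θ : Param d M => ∑ m, capacity (θ.2 m))
      (μ.map fun ω => (X ω, ε ω)) := by
    rw [hμ.map_eq_withDensity, integrable_withDensity_iff_integrable_smul'
      hp₀.measurable.ennreal_ofReal (.of_forall fun _ => ENNReal.ofReal_lt_top)]
    simp only [ENNReal.toReal_ofReal (hp₀.nonneg _), smul_eq_mul, Finset.mul_sum]
    exact integrable_finsetSum _ fun m _ => hp₀.integrable_mul_capacity m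
  exact hparam.comp_measurable (hμ.measurable_target.prodMk hμ.measurable_crossover)

theorem condExp_mul_evidence (hp₀ : IsParamDensity p₀) (hμ : HasLikelihood p₀ X ε Y q μ)
    (n : ℕ) {g : Ω → ℝ} (hg : Integrable g μ) (ω : Ω) :
    (μ[g | info Y n 0]) ω * evidence p₀ q n (resp Y ω) =
      ∫ ω' in cylinder Y n 0 (resp Y ω), g ω' ∂μ := by
  have := hμ.isProbabilityMeasure
  rw [← hμ.measureReal_cylinder hp₀, info_eq_comap_history, cylinder_resp]
  exact condExp_comap_mul_measureReal (measurable_history hμ.measurable_response n) hg ω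

theorem condExp_sum_capacity_mul_evidence (hp₀ : IsParamDensity p₀)
    (hμ : HasLikelihood p₀ X ε Y q μ) (n : ℕ) (ω : Ω) :
    (μ[fun ω => ∑ m, capacity (ε ω m) | info Y n 0]) ω * evidence p₀ q n (resp Y ω) =
      ∫ θ, posteriorWeight p₀ q n (resp Y ω) θ * ∑ m, capacity (θ.2 m) := by
  rw [hμ.condExp_mul_evidence hp₀ n (hμ.integrable_sum_capacity hp₀)]
  exact hμ.setIntegral_cylinder_comp hp₀ n _ measurable_sum_capacity

theorem integral_condExp_sum_capacity (hp₀ : IsParamDensity p₀)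
    (hμ : HasLikelihood p₀ X ε Y q μ) (n : ℕ) :
    ∫ ω, (μ[fun ω => ∑ m, capacity (ε ω m) | info Y n 0]) ω ∂μ =
      ∫ θ, (∑ m, capacity (θ.2 m)) * p₀ θ := by
  have := hμ.isProbabilityMeasure
  have hinfo : info Y n 0 ≤ ‹MeasurableSpace Ω› :=
    info_eq_comap_history Y n ▸ (measurable_history hμ.measurable_response n).comap_le
  rw [integral_condExp hinfo]
  simpa [cylinder_zero_zero, posteriorWeight, mul_comm] using
    hμ.setIntegral_cylinder_comp hp₀ 0 default measurable_sum_capacity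

theorem map_cond_cylinder (hp₀ : IsParamDensity p₀) (hμ : HasLikelihood p₀ X ε Y q μ) {n : ℕ}
    {h : Responses M} (hpos : 0 < evidence p₀ q n h) :
    (μ[|cylinder Y n 0 h]).map (fun ω => (X ω, ε ω)) = volume.withDensity fun θ =>
      ENNReal.ofReal ((evidence p₀ q n h)⁻¹ * posteriorWeight p₀ q n h θ) := by
  rw [ProbabilityTheory.cond, Measure.map_smul, hμ.map_restrict_cylinder,
    hμ.measure_cylinder hp₀, ← ENNReal.ofReal_inv_of_pos hpos,
    ← withDensity_smul _ (hp₀.posteriorWeight q n h).measurable.ennreal_ofReal]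
  simp only [ENNReal.ofReal_mul (inv_nonneg.2 hpos.le)]
  rfl

theorem posterior_of_mem_cylinder {n : ℕ} {h : Responses M} {ω : Ω}
    (hω : ω ∈ cylinder Y n 0 h) :
    posterior X ε Y μ n ω = (μ[|cylinder Y n 0 h]).map fun ω => (X ω, ε ω) := by
  have hpast : {ω' | ∀ k < n, ∀ m, Y k m ω' = Y k m ω} = cylinder Y n 0 h := by
    rw [← cylinder_resp_of_mem hω]
    simp only [cylinder, before_zero_iff]
    exact Set.ext fun _ => forall_congr' fun _ => forall_comm
  rw [posterior, hpast]

theorem log_two_mul_setIntegral_diffEntropy_posterior (hp₀ : IsParamDensity p₀)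
    (hμ : HasLikelihood p₀ X ε Y q μ) (n : ℕ) (h : Responses M) :
    Real.log 2 * ∫ ω in cylinder Y n 0 h, diffEntropy (posterior X ε Y μ n ω) ∂μ =
      (∫ θ, Real.negMulLog (posteriorWeight p₀ q n h θ)) -
        Real.negMulLog (evidence p₀ q n h) := by
  have hf := hp₀.posteriorWeight q n h
  rw [setIntegral_congr_fun (hμ.measurableSet_cylinder n h) fun ω hω =>
    congrArg diffEntropy (posterior_of_mem_cylinder hω), setIntegral_const, smul_eq_mul,
    hμ.measureReal_cylinder hp₀]
  rcases (hp₀.evidence_nonneg q n h).eq_or_lt' with hzero | hpos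
  · have hf_ae := (integral_eq_zero_iff_of_nonneg hf.nonneg hf.integrable).1 hzero
    have hlog : ∫ θ, Real.negMulLog (posteriorWeight p₀ q n h θ) = 0 :=
      integral_eq_zero_of_ae (hf_ae.mono fun θ hθ => by simp [hθ])
    rw [hzero, hlog]
    simp
  · rw [hμ.map_cond_cylinder hp₀ hpos]
    exact hf.log_two_mul_integral_mul_diffEntropy hpos

theorem integrable_diffEntropy_posterior (hμ : HasLikelihood p₀ X ε Y q μ) (n : ℕ) :
    Integrable (fun ω => diffEntropy (posterior X ε Y μ n ω)) μ := by
  have := hμ.isProbabilityMeasure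
  have hfactor (ω : Ω) : posterior X ε Y μ n ω =
      (μ[|history Y n ⁻¹' {history Y n ω}]).map fun ω => (X ω, ε ω) := by
    rw [posterior_of_mem_cylinder (h := resp Y ω) fun _ _ _ => rfl, cylinder_resp]
  simp only [hfactor]
  exact integrable_comp_of_finite (measurable_history hμ.measurable_response n)
    fun a => diffEntropy ((μ[|history Y n ⁻¹' {a}]).map fun ω => (X ω, ε ω))

theorem log_two_mul_setIntegral_diffEntropy_posterior_succ (hp₀ : IsParamDensity p₀)
    (hμ : HasLikelihood p₀ X ε Y q μ) (n : ℕ) (h : Responses M) :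
    Real.log 2 * ∫ ω in cylinder Y n 0 h, diffEntropy (posterior X ε Y μ (n + 1) ω) ∂μ =
      (∫ θ, Real.negMulLog (posteriorWeight p₀ q n h θ)) +
        (∫ θ, posteriorWeight p₀ q n h θ * ∑ m, Real.binEntropy (θ.2 m)) -
        ∑ y, Real.negMulLog (evidence p₀ q (n + 1) (Function.update h n y)) := by
  have hf := hp₀.posteriorWeight q n h
  have hanswer : Measurable fun ω m => Y n m ω :=
    measurable_pi_lambda _ (hμ.measurable_response n)
  rw [setIntegral_eq_sum_inter_preimage_singleton hanswer (hμ.measurableSet_cylinder n h)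
    (hμ.integrable_diffEntropy_posterior (n + 1)), Finset.mul_sum]
  simp only [← cylinder_succ_update, hμ.log_two_mul_setIntegral_diffEntropy_posterior hp₀,
    Finset.sum_sub_distrib, sum_integral_negMulLog_posteriorWeight_update hp₀]
  rw [integral_add hf.integrable_negMulLog hf.integrable_mul_sum_binEntropy]

theorem log_two_mul_evidence_mul_sub_cycleLoss (hp₀ : IsParamDensity p₀)
    (hμ : HasLikelihood p₀ X ε Y q μ) (n : ℕ) (ω : Ω) :
    Real.log 2 * (evidence p₀ q n (resp Y ω) *
        ((μ[fun ω => ∑ m, capacity (ε ω m) | info Y n 0]) ω - cycleLoss X ε Y μ n ω)) =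
      Real.negMulLog (evidence p₀ q n (resp Y ω)) +
        evidence p₀ q n (resp Y ω) * Real.log (Fintype.card (Fin M → Bool)) -
        ∑ y, Real.negMulLog (evidence p₀ q (n + 1) (Function.update (resp Y ω) n y)) := by
  have hint := hμ.integrable_diffEntropy_posterior
  have hcapacity := congrArg (Real.log 2 * ·) (hμ.condExp_sum_capacity_mul_evidence hp₀ n ω)
  have hloss := congrArg (Real.log 2 * ·)
    (hμ.condExp_mul_evidence hp₀ n ((hint n).sub (hint (n + 1))) ω)
  simp only [Pi.sub_apply] at hloss
  rw [integral_sub (hint n).restrict (hint (n + 1)).restrict, mul_sub,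
    hμ.log_two_mul_setIntegral_diffEntropy_posterior hp₀,
    hμ.log_two_mul_setIntegral_diffEntropy_posterior_succ hp₀] at hloss
  simp only [(hp₀.posteriorWeight q n _).log_two_mul_integral_mul_sum_capacity] at hcapacity
  rw [cycleLoss]
  simp only [evidence] at *
  linear_combination hcapacity - hloss

variable {q' : SeqPolicy d M} {μ' : Measure Ω} {n : ℕ}

theorem cycleLoss_le (hp₀ : IsParamDensity p₀) (hμ : HasLikelihood p₀ X ε Y q μ) {ω : Ω}
    (hω : 0 < evidence p₀ q n (resp Y ω)) :
    cycleLoss X ε Y μ n ω ≤ (μ[fun ω => ∑ m, capacity (ε ω m) | info Y n 0]) ω := by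
  have hgap : 0 ≤ Real.log 2 * (evidence p₀ q n (resp Y ω) *
      ((μ[fun ω => ∑ m, capacity (ε ω m) | info Y n 0]) ω - cycleLoss X ε Y μ n ω)) := by
    rw [hμ.log_two_mul_evidence_mul_sub_cycleLoss hp₀, sub_nonneg, ← sum_evidence_update hp₀]
    exact sum_negMulLog_le fun y => hp₀.evidence_nonneg q (n + 1) _
  exact sub_nonneg.1 (nonneg_of_mul_nonneg_right
    (nonneg_of_mul_nonneg_right hgap (Real.log_pos one_lt_two)) hω)

theorem condExp_sum_capacity_eq_of_samePast (hp₀ : IsParamDensity p₀)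
    (hμ : HasLikelihood p₀ X ε Y q μ) (hμ' : HasLikelihood p₀ X ε Y q' μ')
    (hq : SeqPolicy.SamePast n q q') {ω : Ω} (hω : 0 < evidence p₀ q n (resp Y ω)) :
    (μ'[fun ω => ∑ m, capacity (ε ω m) | info Y n 0]) ω =
      (μ[fun ω => ∑ m, capacity (ε ω m) | info Y n 0]) ω := by
  have hmul := hμ'.condExp_sum_capacity_mul_evidence hp₀ n ω
  rw [evidence_eq_of_samePast hq, posteriorWeight_eq_of_samePast hq,
    ← hμ.condExp_sum_capacity_mul_evidence hp₀ n ω] at hmul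
  exact mul_right_cancel₀ hω.ne' hmul

theorem cycleLoss_ae_le (hp₀ : IsParamDensity p₀) (hμ : HasLikelihood p₀ X ε Y q μ)
    (hμ' : HasLikelihood p₀ X ε Y q' μ') (hq : SeqPolicy.SamePast n q q') :
    cycleLoss X ε Y μ' n ≤ᵐ[μ] μ[fun ω => ∑ m, capacity (ε ω m) | info Y n 0] := by
  filter_upwards [hμ.ae_evidence_pos hp₀ n] with ω hω
  rw [← hμ.condExp_sum_capacity_eq_of_samePast hp₀ hμ' hq hω]
  exact hμ'.cycleLoss_le hp₀ (by rwa [evidence_eq_of_samePast hq])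

theorem ae_tendsto_cycleLoss (hp₀ : IsParamDensity p₀) (hμ : HasLikelihood p₀ X ε Y q μ)
    (i : Fin d) {q' : ℕ → SeqPolicy d M} {μ' : ℕ → Measure Ω}
    (hμ' : ∀ k, HasLikelihood p₀ X ε Y (q' k) (μ' k)) (hq : ∀ k, SeqPolicy.SamePast n q (q' k))
    (hquery : ∀ k m h, (q' k).query n m h = dyadicQuery i (k + m)) :
    ∀ᵐ ω ∂μ, Tendsto (fun k => cycleLoss X ε Y (μ' k) n ω) atTop
      (𝓝 ((μ[fun ω => ∑ m, capacity (ε ω m) | info Y n 0]) ω)) := by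
  filter_upwards [hμ.ae_evidence_pos hp₀ n] with ω hω
  set Z := evidence p₀ q n (resp Y ω)
  set C := (μ[fun ω => ∑ m, capacity (ε ω m) | info Y n 0]) ω
  have hevidence (y : Fin M → Bool) := tendsto_evidence_dyadicQuery hp₀ i
    (fun k => posteriorWeight_eq_of_samePast (h := resp Y ω) (hq k)) hquery y
  have hsum : Tendsto (fun k => ∑ y, Real.negMulLog
      (evidence p₀ (q' k) (n + 1) (Function.update (resp Y ω) n y))) atTop
      (𝓝 (Real.negMulLog Z + Z * Real.log (Fintype.card (Fin M → Bool)))) := by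
    rw [← card_mul_negMulLog_inv_card_mul, ← nsmul_eq_mul, ← Finset.card_univ,
      ← Finset.sum_const]
    exact tendsto_finsetSum _ fun y _ =>
      (Real.continuous_negMulLog.tendsto _).comp (hevidence y)
  have hgap (k : ℕ) : Real.log 2 * (Z * (C - cycleLoss X ε Y (μ' k) n ω)) =
      Real.negMulLog Z + Z * Real.log (Fintype.card (Fin M → Bool)) -
        ∑ y, Real.negMulLog (evidence p₀ (q' k) (n + 1) (Function.update (resp Y ω) n y)) := by
    have h := (hμ' k).log_two_mul_evidence_mul_sub_cycleLoss hp₀ n ω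
    rwa [evidence_eq_of_samePast (hq k),
      hμ.condExp_sum_capacity_eq_of_samePast hp₀ (hμ' k) (hq k) hω] at h
  have hgap_zero : Tendsto (fun k => Real.log 2 * (Z * (C - cycleLoss X ε Y (μ' k) n ω))) atTop
      (𝓝 0) := by
    simpa only [hgap, sub_self] using
      hsum.const_sub (Real.negMulLog Z + Z * Real.log (Fintype.card (Fin M → Bool)))
  have hlog : Real.log 2 ≠ 0 := (Real.log_pos one_lt_two).ne'
  have hloss := (hgap_zero.const_mul (Z⁻¹ * (Real.log 2)⁻¹)).const_sub C
  simpa [mul_assoc, hlog, hω.ne'] using hloss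

end HasLikelihood

section Policies

variable {d M : ℕ}

/-- The joint policy that follows `π` in the cycles before `n` and from then on asks player `m`
for the binary digit with index `k + m` of the coordinate `i`. -/
def JointPolicy.thenDyadic (π : JointPolicy d M) (n : ℕ) (i : Fin d) (k : ℕ) :
    JointPolicy d M where
  query l m y := if l < n then π.query l m y else dyadicQuery i (k + m)
  measurableSet_query l m y := by
    split_ifs
    exacts [π.measurableSet_query l m y, measurableSet_dyadicQuery i _]
  adapted l m y y' h := by rw [π.adapted l m y y' h]

/-- The sequential policy that follows `q` in the cycles before `n` and from then on asks player
`m` for the binary digit with index `k + m` of the coordinate `i`. -/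
def SeqPolicy.thenDyadic (q : SeqPolicy d M) (n : ℕ) (i : Fin d) (k : ℕ) : SeqPolicy d M where
  query l m y := if l < n then q.query l m y else dyadicQuery i (k + m)
  measurableSet_query l m y := by
    split_ifs
    exacts [q.measurableSet_query l m y, measurableSet_dyadicQuery i _]
  adapted l m y y' h := by rw [q.adapted l m y y' h]

theorem JointPolicy.samePast_thenDyadic (π : JointPolicy d M) (n : ℕ) (i : Fin d) (k : ℕ) :
    JointPolicy.SamePast n π (π.thenDyadic n i k) := fun l hl => by
  simp only [thenDyadic, hl, if_true]

theorem SeqPolicy.samePast_thenDyadic (q : SeqPolicy d M) (n : ℕ) (i : Fin d) (k : ℕ) :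
    SeqPolicy.SamePast n q (q.thenDyadic n i k) := fun l hl => by
  simp only [thenDyadic, hl, if_true]

variable {Ω : Type*} [MeasurableSpace Ω] {p₀ : Param d M → ℝ} {X : Ω → Target d}
  {ε : Ω → Fin M → ℝ} {Y : ℕ → Fin M → Ω → Bool}

theorem isMaxSeqLoss_condExp_sum_capacity (i : Fin d) (hp₀ : IsParamDensity p₀)
    {Q : SeqPolicy d M → Measure Ω} (hQ : ∀ σ, IsSeqScheme p₀ X ε Y σ (Q σ)) (n : ℕ)
    (σ : SeqPolicy d M) :
    IsMaxSeqLoss X ε Y Q σ n ((Q σ)[fun ω => ∑ m, capacity (ε ω m) | info Y n 0]) := by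
  have hlik (σ : SeqPolicy d M) := (hQ σ).hasLikelihood hp₀
  refine isEssSup_of_ae_tendsto ?_ (fun k => ⟨_, σ.samePast_thenDyadic n i k, rfl⟩)
    ((hlik σ).ae_tendsto_cycleLoss hp₀ i (fun k => hlik (σ.thenDyadic n i k))
      (σ.samePast_thenDyadic n i) fun k m h => if_neg (lt_irrefl n))
  rintro _ ⟨σ', hσ', rfl⟩
  exact (hlik σ).cycleLoss_ae_le hp₀ (hlik σ') hσ'

theorem isMaxJointLoss_condExp_sum_capacity (i : Fin d) (hp₀ : IsParamDensity p₀)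
    {P : JointPolicy d M → Measure Ω} (hP : ∀ π, IsJointScheme p₀ X ε Y π (P π)) (n : ℕ)
    (π : JointPolicy d M) :
    IsMaxJointLoss X ε Y P π n ((P π)[fun ω => ∑ m, capacity (ε ω m) | info Y n 0]) := by
  have hlik (π : JointPolicy d M) := (hP π).hasLikelihood hp₀
  refine isEssSup_of_ae_tendsto ?_ (fun k => ⟨_, π.samePast_thenDyadic n i k, rfl⟩)
    ((hlik π).ae_tendsto_cycleLoss hp₀ i (fun k => hlik (π.thenDyadic n i k))
      (π.samePast_thenDyadic n i) fun k m h => if_neg (lt_irrefl n))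
  rintro _ ⟨π', hπ', rfl⟩
  exact (hlik π).cycleLoss_ae_le hp₀ (hlik π') hπ'

end Policies

end TwentyQuestions

open TwentyQuestions in
theorem theorem7_general {d M : ℕ} (hd : 0 < d) (p₀ : Param d M → ℝ) (hp₀ : IsParamDensity p₀)
    {Ω : Type*} [MeasurableSpace Ω] (X : Ω → Target d) (ε : Ω → Fin M → ℝ)
    (Y : ℕ → Fin M → Ω → Bool) (P : JointPolicy d M → Measure Ω)
    (hP : ∀ π, IsJointScheme p₀ X ε Y π (P π))
    {Ω' : Type*} [MeasurableSpace Ω'] (X' : Ω' → Target d) (ε' : Ω' → Fin M → ℝ)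
    (Y' : ℕ → Fin M → Ω' → Bool) (Q : SeqPolicy d M → Measure Ω')
    (hQ : ∀ σ, IsSeqScheme p₀ X' ε' Y' σ (Q σ)) (n : ℕ) :
    (∀ σ, IsMaxSeqLoss X' ε' Y' Q σ n
      ((Q σ)[fun ω => ∑ m, capacity (ε' ω m) | info Y' n 0])) ∧
    (∀ π, IsMaxJointLoss X ε Y P π n
      ((P π)[fun ω => ∑ m, capacity (ε ω m) | info Y n 0])) ∧
    (∀ σ π (Gseq : Ω' → ℝ) (G : Ω → ℝ), IsMaxSeqLoss X' ε' Y' Q σ n Gseq →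
      IsMaxJointLoss X ε Y P π n G →
      ∫ ω, Gseq ω ∂(Q σ) = ∫ θ, (∑ m, capacity (θ.2 m)) * p₀ θ ∧
      ∫ ω, G ω ∂(P π) = ∫ θ, (∑ m, capacity (θ.2 m)) * p₀ θ) := by
  have hseq := isMaxSeqLoss_condExp_sum_capacity ⟨0, hd⟩ hp₀ hQ n
  have hjoint := isMaxJointLoss_condExp_sum_capacity ⟨0, hd⟩ hp₀ hP n
  refine ⟨hseq, hjoint, fun σ π Gseq G hGseq hG => ⟨?_, ?_⟩⟩
  · rw [integral_congr_ae (IsEssSup.ae_eq hGseq (hseq σ))]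
    exact ((hQ σ).hasLikelihood hp₀).integral_condExp_sum_capacity hp₀ n
  · rw [integral_congr_ae (IsEssSup.ae_eq hG (hjoint π))]
    exact ((hP π).hasLikelihood hp₀).integral_condExp_sum_capacity hp₀ n

open TwentyQuestions in
theorem theorem7 {d M : ℕ} (hd : 0 < d) (p₀ : Param d M → ℝ) (hp₀ : IsPrior p₀)
    {Ω : Type*} [MeasurableSpace Ω] (X : Ω → Target d) (ε : Ω → Fin M → ℝ)
    (Y : ℕ → Fin M → Ω → Bool) (P : JointPolicy d M → Measure Ω)
    (hP : ∀ π, IsJointScheme p₀ X ε Y π (P π))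
    {Ω' : Type*} [MeasurableSpace Ω'] (X' : Ω' → Target d) (ε' : Ω' → Fin M → ℝ)
    (Y' : ℕ → Fin M → Ω' → Bool) (Q : SeqPolicy d M → Measure Ω')
    (hQ : ∀ σ, IsSeqScheme p₀ X' ε' Y' σ (Q σ)) (n : ℕ) :
    (∀ σ, IsMaxSeqLoss X' ε' Y' Q σ n
      ((Q σ)[fun ω => ∑ m, capacity (ε' ω m) | info Y' n 0])) ∧
    (∀ π, IsMaxJointLoss X ε Y P π n
      ((P π)[fun ω => ∑ m, capacity (ε ω m) | info Y n 0])) ∧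
    (∀ σ π (Gseq : Ω' → ℝ) (G : Ω → ℝ), IsMaxSeqLoss X' ε' Y' Q σ n Gseq →
      IsMaxJointLoss X ε Y P π n G →
      ∫ ω, Gseq ω ∂(Q σ) = ∫ θ, (∑ m, capacity (θ.2 m)) * p₀ θ ∧
      ∫ ω, G ω ∂(P π) = ∫ θ, (∑ m, capacity (θ.2 m)) * p₀ θ) :=
  theorem7_general hd p₀ hp₀.isParamDensity X ε Y P hP X' ε' Y' Q hQ n
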